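/- Let $\mathfrak g$ be a finite-dimensional complex simple Lie algebra with Cartan subalgebra $\mathfrak h$, roots $\Delta$ and simple roots $\Delta^0$. A \emph{$|k|$-grading} of a Lie algebra $\mathfrak l$ is a vector space decomposition $\mathfrak l=\mathfrak l_k\oplus\dots\oplus\mathfrak l_{-k}$ with $[\mathfrak l_i,\mathfrak l_j]\subset\mathfrak l_{i+j}$ (where $\mathfrak l_j=0$ for $|j|>k$), $[\mathfrak l_{-1},\mathfrak l_j]=\mathfrak l_{j-1}$ for $j<0$, and $\mathfrak l_k\neq0\neq\mathfrak l_{-k}$. A Lie algebra with a $|k|$-grading, for some $k$, is \emph{of Monge type} if $\mathfrak l_{-1}$ contains a nonzero abelian subalgebra $\mathfrak y$ of codimension $1$ in $\mathfrak l_{-1}$ with $\dim\mathfrak l_{-2}=\dim\mathfrak y$. For a set $\Sigma\subset\Delta^0$, the height of a root $\beta=\sum_{\alpha\in\Delta^0}n_\alpha\alpha$ is $\operatorname{ht}_\Sigma(\beta)=\sum_{\alpha\in\Sigma}n_\alpha$, and the grading of $\mathfrak g$ defined by $\Sigma$ is $\mathfrak g_j=\bigoplus_{\operatorname{ht}_\Sigma(\beta)=j}\mathfrak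 g_\beta$ for $j\neq0$ and $\mathfrak g_0=\mathfrak h\oplus\bigoplus_{\operatorname{ht}_\Sigma(\beta)=0}\mathfrak g_\beta$. For $\Upsilon\subset\Delta^0$ let $\mathfrak g(\Upsilon)\subset\mathfrak g$ be the subalgebra generated by the root spaces $\mathfrak g_{\pm\beta}$, $\beta\in\Upsilon$; it is the semisimple Lie algebra with Dynkin diagram $\Upsilon$, with Cartan subalgebra spanned by the coroots of the elements of $\Upsilon$ and with the roots of $\mathfrak g$ that are combinations of elements of $\Upsilon$. A subset of $\Upsilon$ defines a grading of $\mathfrak g(\Upsilon)$ by the same formulas. \textbf{Theorem.} Let $\mathfrak g$ be graded by $\Sigma\subset\Delta^0$ and suppose $\dim\mathfrak g_{-1}>2$. Then $\mathfrak g$ with this grading is of Monge type if and only if there is a root $\zeta\in\Sigma$ such that (i) $\Sigma\setminus\{\zeta\}$ is exactly the set of simple roots adjacent to $\zeta$ in the Dynkin diagram of $\mathfrak g$; and (ii) for each $\alpha\in\Sigma\setminus\{\zeta\}$, the grading of $\mathfrak g(\Upsilon_\alpha)$ defined by $\{\alpha\}$ is a $|1|$-grading, where $\Upsilon_\alpha$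 is the connected component containing $\alpha$ of the Dynkin diagram of $\mathfrak g$ with the node $\zeta$ removed. -/

import Mathlib

open LieAlgebra LieAlgebra.IsKilling

noncomputable section

namespace Monge

/-- A family `𝒢 : ℤ → Submodule ℂ L` of subspaces is a `|k|`-grading of the Lie algebra `L`:
`L = 𝒢 k ⊕ ⋯ ⊕ 𝒢 (-k)`, `[𝒢 i, 𝒢 j] ⊆ 𝒢 (i + j)`, the negative part is generated by `𝒢 (-1)` in
the sense that `[𝒢 (-1), 𝒢 j] = 𝒢 (j - 1)` for `j < 0`, and `𝒢 k`, `𝒢 (-k)` are nonzero. -/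
structure IsDepthGrading {L : Type*} [LieRing L] [LieAlgebra ℂ L]
    (k : ℕ) (𝒢 : ℤ → Submodule ℂ L) : Prop where
  isInternal : DirectSum.IsInternal 𝒢
  eq_bot_of_lt : ∀ j : ℤ, (k : ℤ) < |j| → 𝒢 j = ⊥
  lie_mem : ∀ (i j : ℤ) (x y : L), x ∈ 𝒢 i → y ∈ 𝒢 j → ⁅x, y⁆ ∈ 𝒢 (i + j)
  generated : ∀ j : ℤ, j < 0 →
    Submodule.span ℂ {z : L | ∃ x ∈ 𝒢 (-1), ∃ y ∈ 𝒢 j, ⁅x, y⁆ = z} = 𝒢 (j - 1)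
  top_ne_bot : 𝒢 k ≠ ⊥
  bottom_ne_bot : 𝒢 (-k) ≠ ⊥

/-- A graded Lie algebra is of Monge type if it is `|k|`-graded for some `k`, and the component of
degree `-1` contains a nonzero abelian subalgebra `𝔶` of codimension one such that the component of
degree `-2` has the dimension of `𝔶`. -/
def IsMongeType {L : Type*} [LieRing L] [LieAlgebra ℂ L] (𝒢 : ℤ → Submodule ℂ L) : Prop :=
  (∃ k : ℕ, IsDepthGrading k 𝒢) ∧
  ∃ 𝔶 : LieSubalgebra ℂ L,
    𝔶.toSubmodule ≤ 𝒢 (-1) ∧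
    IsLieAbelian 𝔶 ∧
    𝔶 ≠ ⊥ ∧
    Module.finrank ℂ (𝒢 (-1)) = Module.finrank ℂ 𝔶 + 1 ∧
    Module.finrank ℂ (𝒢 (-2)) = Module.finrank ℂ 𝔶

variable {𝔤 : Type*} [LieRing 𝔤] [LieAlgebra ℂ 𝔤] [FiniteDimensional ℂ 𝔤] [IsKilling ℂ 𝔤]
  {H : LieSubalgebra ℂ 𝔤} [H.IsCartanSubalgebra]

/-- The coefficient `n_α` of the simple root `α` in `γ = ∑ n_α α`. -/
def coeff (b : (rootSystem H).Base) (γ : H.root) (α : b.support) : ℤ :=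
  b.toWeightBasisInt.repr ((rootSystem H).rootSpanMem ℤ γ) α

/-- The height of a root relative to a set `S` of simple roots. -/
def heightRel (b : (rootSystem H).Base) (S : Finset b.support) (γ : H.root) : ℤ :=
  ∑ α ∈ S, coeff b γ α

/-- The direct sum of the root spaces of those roots of `R` that have height `j` relative to `S`,
together with `𝔱` when `j = 0`. -/
def gradedPiece (b : (rootSystem H).Base) (𝔱 : Submodule ℂ 𝔤) (R : Set H.root)
    (S : Finset b.support) (j : ℤ) : Submodule ℂ 𝔤 :=
  (if j = 0 then 𝔱 else ⊥) ⊔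
    ⨆ γ : H.root, ⨆ _ : γ ∈ R ∧ heightRel b S γ = j, (rootSpace H γ.1).toSubmodule

/-- The grading of `𝔤` defined by a set `S` of simple roots. -/
def grading (b : (rootSystem H).Base) (S : Finset b.support) (j : ℤ) : Submodule ℂ 𝔤 :=
  gradedPiece b H.toSubmodule Set.univ S j

/-- The graph underlying the Dynkin diagram: distinct simple roots are adjacent if they are not
orthogonal. -/
def dynkin (b : (rootSystem H).Base) : SimpleGraph b.support where
  Adj α β := α ≠ β ∧ (rootSystem H).pairing α β ≠ 0
  symm := ⟨fun _ _ h => ⟨h.1.symm, fun h0 => h.2 ((rootSystem H).pairing_eq_zero_iff.mp h0)⟩⟩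
  loopless := ⟨fun _ h => h.1 rfl⟩

/-- The connected component that contains `α` of the Dynkin diagram with the node `ζ` removed. -/
def component (b : (rootSystem H).Base) (ζ α : b.support) : Set b.support :=
  {β | ∃ (hα : α ∈ ({ζ}ᶜ : Set b.support)) (hβ : β ∈ ({ζ}ᶜ : Set b.support)),
    ((dynkin b).induce ({ζ}ᶜ : Set b.support)).Reachable ⟨α, hα⟩ ⟨β, hβ⟩}

/-- The semisimple Lie algebra `𝔤(Υ)` whose Dynkin diagram is the full subdiagram `Υ`, realised as
the subalgebra of `𝔤` generated by the root spaces of `±β` for `β ∈ Υ`. -/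
def subdiagramAlgebra (b : (rootSystem H).Base) (Υ : Set b.support) : LieSubalgebra ℂ 𝔤 :=
  LieSubalgebra.lieSpan ℂ 𝔤
    (⋃ β ∈ Υ, ((rootSpace H β.1.1 : Set 𝔤) ∪ (rootSpace H (-β.1.1) : Set 𝔤)))

/-- The Cartan subalgebra of `𝔤(Υ)`: the span of the coroots of the simple roots in `Υ`. -/
def subdiagramCartan (b : (rootSystem H).Base) (Υ : Set b.support) : Submodule ℂ 𝔤 :=
  Submodule.span ℂ ((fun β : b.support => (((rootSystem H).coroot β : H) : 𝔤)) '' Υ)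

/-- The roots of `𝔤(Υ)`: the roots of `𝔤` that are combinations of the simple roots in `Υ`. -/
def subdiagramRoots (b : (rootSystem H).Base) (Υ : Set b.support) : Set H.root :=
  {γ | ∀ β : b.support, β ∉ Υ → coeff b γ β = 0}

/-- The grading of the Lie algebra `𝔤(Υ)` defined by a set `S` of simple roots. -/
def subdiagramGrading (b : (rootSystem H).Base) (Υ : Set b.support) (S : Finset b.support)
    (j : ℤ) : Submodule ℂ (subdiagramAlgebra b Υ) :=
  (gradedPiece b (subdiagramCartan b Υ) (subdiagramRoots b Υ) S j).comap
    (subdiagramAlgebra b Υ).toSubmodule.subtype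

end Monge

end

/-!
Choose a nonzero vector `e γ` in each root space. The proof goes through a condition on roots.
Call a root `ζ` of height one (relative to `S`) a *Monge root* if no two other roots of height one
add up to a root, while `ζ + γ` is a root for every other root `γ` of height one (`IsMongeRoot`).

The grading is of Monge type if and only if there is a Monge root
(`exists_isMongeRoot_of_isMongeType`, `isMongeType_of_isMongeRoot`). If `𝔶 ⊆ 𝔤 (-1)` is abelian of
codimension one and `e γ₀ ∉ 𝔶`, then `𝔶` contains some `e γ + c • e γ₀` for every other root `γ`
of height `-1`, and looking at single weights in the brackets of these vectors shows that the
vectors `e γ` commute with each other. So `𝔶` may be replaced by their span. As `𝔤 (-2)` is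
generated by `𝔤 (-1)`, it is spanned by the brackets `⁅e γ₀, e γ⁆`, and its dimension says that
none of them is zero.

A Monge root `ζ` and another root of height one never differ by a root (`IsMongeRoot.sub_notMem`):
this is the Jacobi identity, applied with a third root of height one, and the only place where
`dim 𝔤 (-1) > 2`, rather than `dim 𝔤 (-1) > 1`, is needed. It follows that `ζ` is simple and that
the other elements of `S` are the neighbours of `ζ`. By induction on the height, `ζ` occurs in
every root of height at least two. The roots of the components of the Dynkin diagram without `ζ`
therefore have height at most one, which gives condition (ii).

Conversely, assume the conditions on the diagram (`isMongeRoot_of_dynkin`). A root `γ ≠ ζ` of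
height one does not contain `ζ`, contains exactly one neighbour of `ζ`, and makes an obtuse angle
with `ζ`, so that `γ + ζ` is a root. If `γ + δ` were a root for two such `γ`, `δ`, then either
they contain the same neighbour `α` and `γ + δ` is a root of the component of `α` with coefficient
two at `α` (`coeff_eq_zero_or_of_component`), or `γ`, `δ`, `ζ` have pairwise obtuse angles, which
is impossible for reasons of length (`false_of_pairwise_obtuse`).

Condition (ii) is translated into coefficients of roots by
`isDepthGrading_one_subdiagramGrading_iff`, which rests on the decomposition of the subalgebra of
a subdiagram into root spaces (`toSubmodule_subdiagramAlgebra`). That the gradings are gradings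
follows from an element of `H` on which every root takes its relative height as value
(`exists_gradingElement`).
-/

open LieAlgebra LieAlgebra.IsKilling

noncomputable section

namespace Monge

open LieModule

variable {𝔤 : Type*} [LieRing 𝔤] [LieAlgebra ℂ 𝔤] [FiniteDimensional ℂ 𝔤] [IsKilling ℂ 𝔤]
  {H : LieSubalgebra ℂ 𝔤} [H.IsCartanSubalgebra]

/-! ### Coefficients of roots with respect to a base -/

section Coefficients

variable (b : (rootSystem H).Base)

lemma coeff_add {i j k : H.root}
    (h : (rootSystem H).root k = (rootSystem H).root i + (rootSystem H).root j)
    (α : b.support) : coeff b k α = coeff b i α + coeff b j α := by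
  have : (rootSystem H).rootSpanMem ℤ k =
      (rootSystem H).rootSpanMem ℤ i + (rootSystem H).rootSpanMem ℤ j := Subtype.ext h
  rw [coeff, this, LinearEquiv.map_add, Finsupp.add_apply, coeff, coeff]

lemma coeff_neg {i k : H.root}
    (h : (rootSystem H).root k = -(rootSystem H).root i)
    (α : b.support) : coeff b k α = -coeff b i α := by
  have : (rootSystem H).rootSpanMem ℤ k = (-1 : ℤ) • (rootSystem H).rootSpanMem ℤ i :=
    Subtype.ext (h.trans (neg_one_smul ℤ _).symm)
  rw [coeff, this, LinearEquiv.map_smul, Finsupp.smul_apply, neg_one_smul, coeff]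

lemma coeff_sub {i j k : H.root}
    (h : (rootSystem H).root k = (rootSystem H).root i - (rootSystem H).root j)
    (α : b.support) : coeff b k α = coeff b i α - coeff b j α := by
  have := coeff_add b (i := k) (j := j) (k := i) (by rw [h]; abel) α
  omega

lemma coeff_sub_zsmul {i j k : H.root} {z : ℤ}
    (h : (rootSystem H).root k = (rootSystem H).root i - z • (rootSystem H).root j)
    (α : b.support) : coeff b k α = coeff b i α - z * coeff b j α := by
  have : (rootSystem H).rootSpanMem ℤ k =
      (rootSystem H).rootSpanMem ℤ i + (-z) • (rootSystem H).rootSpanMem ℤ j :=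
    Subtype.ext (h.trans (by rw [sub_eq_add_neg, ← neg_smul]; rfl))
  rw [coeff, this, LinearEquiv.map_add, LinearEquiv.map_smul, Finsupp.add_apply,
    Finsupp.smul_apply, smul_eq_mul, coeff, coeff]
  ring

open scoped Classical in
lemma coeff_simple (α β : b.support) : coeff b α β = if α = β then 1 else 0 := by
  have : (rootSystem H).rootSpanMem ℤ α = b.toWeightBasisInt α :=
    Subtype.ext (by simp only [RootPairing.Base.coe_toWeightBasisInt_apply])
  rw [coeff, this, Module.Basis.repr_self, Finsupp.single_apply]

@[simp] lemma coeff_simple_self (α : b.support) : coeff b α α = 1 := by simp [coeff_simple]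

lemma coeff_simple_of_ne {α β : b.support} (h : α ≠ β) : coeff b α β = 0 := by
  simp [coeff_simple, h]

lemma root_eq_sum_coeff (i : H.root) :
    (rootSystem H).root i = ∑ α : b.support, coeff b i α • (rootSystem H).root α := by
  have h := congrArg Subtype.val
    (b.toWeightBasisInt.sum_repr ((rootSystem H).rootSpanMem ℤ i))
  simp only [AddSubmonoidClass.coe_finsetSum, Submodule.coe_smul,
    RootPairing.Base.coe_toWeightBasisInt_apply] at h
  exact h.symm

lemma eq_of_coeff_eq {i j : H.root} (h : ∀ α, coeff b i α = coeff b j α) : i = j := by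
  apply (rootSystem H).root.injective
  rw [root_eq_sum_coeff b i, root_eq_sum_coeff b j]
  simp [h]

lemma exists_coeff_ne_zero (i : H.root) : ∃ α, coeff b i α ≠ 0 := by
  by_contra! h
  exact (rootSystem H).ne_zero i (by rw [root_eq_sum_coeff b i]; simp [h])

lemma coeff_nonneg_or_nonpos (i : H.root) :
    (∀ α, 0 ≤ coeff b i α) ∨ (∀ α, coeff b i α ≤ 0) := by
  obtain ⟨f, -, hf⟩ := b.exists_root_eq_sum_nat_or_neg i
  have key : ∀ g : H.root → ℤ,
      (rootSystem H).root i = ∑ j ∈ b.support, g j • (rootSystem H).root j →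
      ∀ α : b.support, coeff b i α = g α := by
    intro g hg
    rw [root_eq_sum_coeff b i, b.support.sum_subtype (p := (· ∈ b.support)) (by simp)
      (F := inferInstance)] at hg
    exact Fintype.linearIndependent_iffₛ.mp (b.linearIndepOn_root.restrict_scalars' ℤ)
      (coeff b i) (fun α ↦ g α) hg
  rcases hf with hf | hf
  · left
    intro α
    rw [key (fun j ↦ (f j : ℤ)) (by simpa using hf) α]
    positivity
  · right
    intro α
    rw [key (fun j ↦ -(f j : ℤ)) (by simpa using hf) α]
    simp

lemma coeff_nonneg_of_pos {i : H.root} {α : b.support} (h : 0 < coeff b i α) (β : b.support) :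
    0 ≤ coeff b i β := by
  rcases coeff_nonneg_or_nonpos b i with h' | h'
  · exact h' β
  · exact absurd (h' α) (by omega)

lemma coeff_nonpos_of_neg {i : H.root} {α : b.support} (h : coeff b i α < 0) (β : b.support) :
    coeff b i β ≤ 0 := by
  rcases coeff_nonneg_or_nonpos b i with h' | h'
  · exact absurd (h' α) (by omega)
  · exact h' β

lemma pairingIn_eq_sum_coeff (i j : H.root) :
    (rootSystem H).pairingIn ℤ i j =
      ∑ α : b.support, coeff b i α * (rootSystem H).pairingIn ℤ α j := by
  apply (algebraMap ℤ ℂ).injective_int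
  simp_rw [map_sum, map_mul, RootPairing.algebraMap_pairingIn,
    ← RootPairing.root_coroot_eq_pairing]
  conv_lhs => rw [root_eq_sum_coeff b i]
  simp [map_sum]

lemma isPos_iff_coeff_nonneg (i : H.root) : b.IsPos i ↔ ∀ α, 0 ≤ coeff b i α := by
  have hh : b.height i = ∑ α : b.support, coeff b i α := by
    have h0 := root_eq_sum_coeff b i
    classical
    have h : (rootSystem H).root i = ∑ j ∈ b.support,
        (fun j ↦ if hj : j ∈ b.support then coeff b i ⟨j, hj⟩ else 0) j •
          (rootSystem H).root j := by
      rw [h0, b.support.sum_subtype (p := (· ∈ b.support)) (by simp) (F := inferInstance)]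
      simp
    rw [RootPairing.Base.height_eq_sum h,
      b.support.sum_subtype (p := (· ∈ b.support)) (by simp) (F := inferInstance)]
    simp
  constructor
  · intro hp
    rw [RootPairing.Base.isPos_iff, hh] at hp
    rcases coeff_nonneg_or_nonpos b i with h | h
    · exact h
    · exact absurd (Finset.sum_nonpos fun α (_ : α ∈ Finset.univ) ↦ h α) (by omega)
  · intro h
    rw [RootPairing.Base.isPos_iff', hh]
    exact Finset.sum_nonneg fun α _ ↦ h α

/-- The root `-γ`. -/
def negRoot (γ : H.root) : H.root := (rootSystem H).reflectionPerm γ γ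

@[simp] lemma root_negRoot (γ : H.root) :
    (rootSystem H).root (negRoot γ) = -(rootSystem H).root γ := by
  simp [negRoot, -rootSystem_root_apply]

@[simp] lemma coeff_negRoot (γ : H.root) (α : b.support) :
    coeff b (negRoot γ) α = -coeff b γ α := coeff_neg b (root_negRoot γ) α

@[simp] lemma negRoot_negRoot (γ : H.root) : negRoot (negRoot γ) = γ :=
  (rootSystem H).root.injective (by rw [root_negRoot, root_negRoot, neg_neg])

lemma negRoot_injective : Function.Injective (negRoot : H.root → H.root) :=
  Function.LeftInverse.injective negRoot_negRoot

lemma root_negRoot_add_negRoot_mem_iff {γ δ : H.root} :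
    (rootSystem H).root (negRoot γ) + (rootSystem H).root (negRoot δ) ∈
        Set.range (rootSystem H).root ↔
      (rootSystem H).root γ + (rootSystem H).root δ ∈ Set.range (rootSystem H).root := by
  constructor
  · rintro ⟨ρ, hρ⟩
    exact ⟨negRoot ρ, by rw [root_negRoot, hρ, root_negRoot, root_negRoot]; abel⟩
  · rintro ⟨ρ, hρ⟩
    exact ⟨negRoot ρ, by rw [root_negRoot, hρ, root_negRoot, root_negRoot]; abel⟩

end Coefficients

/-! ### Heights relative to a set of simple roots -/

section Height

variable (b : (rootSystem H).Base) (S : Finset b.support)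

lemma heightRel_add {i j k : H.root}
    (h : (rootSystem H).root k = (rootSystem H).root i + (rootSystem H).root j) :
    heightRel b S k = heightRel b S i + heightRel b S j := by
  simp [heightRel, coeff_add b h, Finset.sum_add_distrib]

lemma heightRel_sub {i j k : H.root}
    (h : (rootSystem H).root k = (rootSystem H).root i - (rootSystem H).root j) :
    heightRel b S k = heightRel b S i - heightRel b S j := by
  simp [heightRel, coeff_sub b h]

@[simp] lemma heightRel_negRoot (γ : H.root) :
    heightRel b S (negRoot γ) = -heightRel b S γ := by
  simp [heightRel]

lemma root_add_ne_zero_of_heightRel {i j : H.root}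
    (h : heightRel b S i + heightRel b S j ≠ 0) :
    (rootSystem H).root i + (rootSystem H).root j ≠ 0 := by
  intro h0
  have h1 : (rootSystem H).root i = -(rootSystem H).root j := eq_neg_of_add_eq_zero_left h0
  rw [← root_negRoot] at h1
  rw [(rootSystem H).root.injective h1, heightRel_negRoot] at h
  omega

variable {S} in
lemma heightRel_simple_of_mem {α : b.support} (h : α ∈ S) : heightRel b S α = 1 := by
  classical simp [heightRel, coeff_simple, h]

variable {S} in
lemma heightRel_simple_of_notMem {α : b.support} (h : α ∉ S) : heightRel b S α = 0 := by
  classical simp [heightRel, coeff_simple, h]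

@[simp] lemma heightRel_singleton (α : b.support) (γ : H.root) :
    heightRel b {α} γ = coeff b γ α := by
  simp [heightRel]

variable {b S} in
lemma coeff_nonneg_of_heightRel_pos {γ : H.root} (h : 0 < heightRel b S γ) (α : b.support) :
    0 ≤ coeff b γ α := by
  rcases coeff_nonneg_or_nonpos b γ with h' | h'
  · exact h' α
  · exact absurd (Finset.sum_nonpos fun β (_ : β ∈ S) ↦ h' β) (by rw [heightRel] at h; omega)

variable {b S} in
lemma exists_coeff_pos_of_heightRel_pos {γ : H.root} (h : 0 < heightRel b S γ) :
    ∃ α ∈ S, 0 < coeff b γ α := by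
  by_contra! h'
  exact absurd (Finset.sum_nonpos h') (by rw [heightRel] at h; omega)

variable {b S} in
/-- A root of relative height one contains exactly one root of `S`. -/
lemma coeff_eq_zero_of_heightRel_eq_one {γ : H.root} (h : heightRel b S γ = 1)
    {α β : b.support} (hα : α ∈ S) (hβ : β ∈ S) (hαβ : α ≠ β) (hpos : 0 < coeff b γ α) :
    coeff b γ β = 0 := by
  have hnn := coeff_nonneg_of_heightRel_pos (b := b) (S := S) (γ := γ) (by omega)
  have := Finset.add_le_sum (f := coeff b γ) (s := S) (fun i _ ↦ hnn i) hα hβ hαβ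
  have h1 := hnn β
  rw [heightRel] at h
  omega

end Height

/-! ### Sums of roots and pairings -/

section Pairing

lemma pairingIn_add {i j k : H.root}
    (h : (rootSystem H).root k = (rootSystem H).root i + (rootSystem H).root j) (l : H.root) :
    (rootSystem H).pairingIn ℤ k l =
      (rootSystem H).pairingIn ℤ i l + (rootSystem H).pairingIn ℤ j l := by
  apply (algebraMap ℤ ℂ).injective_int
  simp only [map_add, RootPairing.algebraMap_pairingIn, ← RootPairing.root_coroot_eq_pairing, h,
    LinearMap.add_apply]

/-- If `i + j` is a root and `i - j` is not, then the angle between `i` and `j` is obtuse. -/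
lemma pairingIn_neg_of_add_mem {i j k : H.root} (hne : i ≠ j)
    (h : (rootSystem H).root k = (rootSystem H).root i + (rootSystem H).root j)
    (hsub : (rootSystem H).root i - (rootSystem H).root j ∉ Set.range (rootSystem H).root) :
    (rootSystem H).pairingIn ℤ i j < 0 := by
  by_contra! h0
  rcases h0.eq_or_lt with h0 | h0
  · -- reflecting `i + j` in `j` gives `i - j`
    apply hsub
    refine ⟨(rootSystem H).reflectionPerm j k, ?_⟩
    rw [RootPairing.root_reflectionPerm, RootPairing.reflection_apply_root' ℤ, pairingIn_add h,
      ← h0, h]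
    simp only [RootPairing.pairingIn_same]
    module
  · exact hsub ((rootSystem H).root_sub_root_mem_of_pairingIn_pos h0 hne)

/-- Adding a root at an obtuse angle does not increase the length. -/
lemma rootLength_le_of_add {i j k : H.root}
    (h : (rootSystem H).root k = (rootSystem H).root i + (rootSystem H).root j)
    (hneg : (rootSystem H).pairingIn ℤ i j < 0) :
    ((rootSystem H).posRootForm ℤ).rootLength k ≤ ((rootSystem H).posRootForm ℤ).rootLength j := by
  set B := (rootSystem H).posRootForm ℤ with hB
  have hji : (rootSystem H).pairingIn ℤ j i < 0 := by
    by_contra! h0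
    rcases h0.eq_or_lt with h0 | h0
    · rw [eq_comm, RootPairing.pairingIn_eq_zero_iff] at h0
      omega
    · rw [RootPairing.zero_lt_pairingIn_iff'] at h0
      omega
  have hk : B.rootLength k = B.rootLength i + B.rootLength j +
      (rootSystem H).pairingIn ℤ j i * B.rootLength i := by
    apply (algebraMap ℤ ℂ).injective_int
    simp only [map_add, map_mul, RootPairing.RootPositiveForm.algebraMap_rootLength,
      RootPairing.algebraMap_pairingIn, ← B.two_mul_apply_root_root, h, LinearMap.add_apply]
    have := B.symm.eq ((rootSystem H).root i) ((rootSystem H).root j)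
    simp only [RingHom.id_apply] at this
    rw [this]
    ring
  have hi := B.rootLength_pos i
  nlinarith

/-- There are no three roots `γ`, `δ`, `ζ` at pairwise obtuse angles such that `γ + δ ≠ ± ζ` and
`γ + ζ ≠ ± δ` are roots. The pairing of `γ + δ` with the coroot of `ζ` is at most `-2`, so `γ + δ`
is longer than `ζ`. It is not longer than `δ`. Likewise, `γ + ζ` is longer than `δ` and not longer
than `ζ`, a contradiction. This is the obstruction to cycles in a Dynkin diagram. -/
lemma false_of_pairwise_obtuse {γ δ ζ ρ σ : H.root}
    (hρ : (rootSystem H).root ρ = (rootSystem H).root γ + (rootSystem H).root δ)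
    (hσ : (rootSystem H).root σ = (rootSystem H).root γ + (rootSystem H).root ζ)
    (hγδ : (rootSystem H).pairingIn ℤ γ δ < 0) (hγζ : (rootSystem H).pairingIn ℤ γ ζ < 0)
    (hδζ : (rootSystem H).pairingIn ℤ δ ζ < 0)
    (h₁ : (rootSystem H).root ρ ≠ (rootSystem H).root ζ)
    (h₂ : (rootSystem H).root ρ ≠ -(rootSystem H).root ζ)
    (h₃ : (rootSystem H).root σ ≠ (rootSystem H).root δ)
    (h₄ : (rootSystem H).root σ ≠ -(rootSystem H).root δ) : False := by
  have hζδ : (rootSystem H).pairingIn ℤ ζ δ < 0 := by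
    by_contra! h0
    rcases h0.eq_or_lt with h0 | h0
    · rw [eq_comm, RootPairing.pairingIn_eq_zero_iff] at h0
      omega
    · rw [RootPairing.zero_lt_pairingIn_iff'] at h0
      omega
  have l₁ := ((rootSystem H).posRootForm ℤ).rootLength_lt_of_pairingIn_notMem h₁ h₂ (by
    rw [pairingIn_add hρ]; simp only [Set.mem_insert_iff, Set.mem_singleton_iff]; omega)
  have l₂ := ((rootSystem H).posRootForm ℤ).rootLength_lt_of_pairingIn_notMem h₃ h₄ (by
    rw [pairingIn_add hσ]; simp only [Set.mem_insert_iff, Set.mem_singleton_iff]; omega)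
  have l₃ := rootLength_le_of_add hρ hγδ
  have l₄ := rootLength_le_of_add hσ hγζ
  omega

end Pairing

/-! ### Supports of roots and components of the Dynkin diagram -/

section Component

variable {b : (rootSystem H).Base}

lemma dynkin_adj_iff {α β : b.support} :
    (dynkin b).Adj α β ↔ α ≠ β ∧ (rootSystem H).pairingIn ℤ α β ≠ 0 := by
  have : (rootSystem H).pairing α β = 0 ↔ (rootSystem H).pairingIn ℤ α β = 0 := by
    rw [← (rootSystem H).algebraMap_pairingIn ℤ]
    simp only [algebraMap_int_eq, eq_intCast, Int.cast_eq_zero]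
  exact and_congr_right fun _ ↦ not_congr this

lemma pairingIn_simple_neg_of_adj {α β : b.support} (h : (dynkin b).Adj α β) :
    (rootSystem H).pairingIn ℤ α β < 0 := by
  obtain ⟨h1, h2⟩ := dynkin_adj_iff.mp h
  exact lt_of_le_of_ne
    (b.pairingIn_le_zero_of_ne (fun h ↦ h1 (Subtype.ext h)) α.2 β.2) h2

lemma pairingIn_simple_eq_zero {α β : b.support} (hne : α ≠ β) (h : ¬ (dynkin b).Adj α β) :
    (rootSystem H).pairingIn ℤ α β = 0 := by
  by_contra h'
  exact h (dynkin_adj_iff.mpr ⟨hne, h'⟩)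

lemma notMem_component_self (ζ α : b.support) : ζ ∉ component b ζ α := by
  rintro ⟨-, hβ, -⟩
  exact hβ rfl

lemma self_mem_component {ζ α : b.support} (h : α ≠ ζ) : α ∈ component b ζ α :=
  ⟨h, h, .refl _⟩

lemma mem_component_of_adj {ζ α β β' : b.support} (h : β ∈ component b ζ α)
    (hβ' : β' ≠ ζ) (hadj : (dynkin b).Adj β β') : β' ∈ component b ζ α := by
  obtain ⟨hα, hβ, hr⟩ := h
  exact ⟨hα, hβ', hr.trans (SimpleGraph.Adj.reachable
    (G := (dynkin b).induce ({ζ}ᶜ : Set b.support)) (u := ⟨β, hβ⟩) (v := ⟨β', hβ'⟩) hadj)⟩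

/-- If `j` is simple and `k = i + j` with `i` a positive root, then `j` is not orthogonal to `i`
unless it occurs in `i`. -/
lemma pairingIn_ne_zero_of_add_simple {i k : H.root} {j : b.support}
    (h : (rootSystem H).root k = (rootSystem H).root i + (rootSystem H).root j)
    (hi : ∀ α, 0 ≤ coeff b i α) (hij : coeff b i j = 0) :
    (rootSystem H).pairingIn ℤ i j ≠ 0 := by
  refine (pairingIn_neg_of_add_mem ?_ h ?_).ne
  · rintro rfl
    simp at hij
  · rintro ⟨l, hl⟩
    obtain ⟨α, hα⟩ := exists_coeff_ne_zero b i
    have hlj := coeff_sub b hl j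
    have hlα := coeff_sub b hl α
    rw [coeff_simple_self] at hlj
    rw [coeff_simple_of_ne b (by rintro rfl; exact hα hij)] at hlα
    have := coeff_nonpos_of_neg b (i := l) (α := j) (by omega) α
    have := hi α
    omega

/-- The support of a positive root that does not contain `ζ` lies in one component of the Dynkin
diagram with `ζ` removed. -/
lemma coeff_eq_zero_or_of_component {γ : H.root} (hγ : b.IsPos γ) {ζ : b.support}
    (hζ : coeff b γ ζ = 0) (α : b.support) :
    (∀ β ∈ component b ζ α, coeff b γ β = 0) ∨ (∀ β ∉ component b ζ α, coeff b γ β = 0) := by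
  suffices (∀ β, 0 ≤ coeff b γ β) ∧ (coeff b γ ζ = 0 →
      (∀ β ∈ component b ζ α, coeff b γ β = 0) ∨ (∀ β ∉ component b ζ α, coeff b γ β = 0)) from
    this.2 hζ
  clear hζ
  refine hγ.induction_on_add (p := fun γ ↦ (∀ β, 0 ≤ coeff b γ β) ∧ (coeff b γ ζ = 0 →
      (∀ β ∈ component b ζ α, coeff b γ β = 0) ∨ (∀ β ∉ component b ζ α, coeff b γ β = 0)))
    ?_ ?_
  · intro i hi
    refine ⟨(isPos_iff_coeff_nonneg b i).mp (b.isPos_of_mem_support hi), fun _ ↦ ?_⟩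
    by_cases hc : (⟨i, hi⟩ : b.support) ∈ component b ζ α
    · right
      intro β hβ
      exact coeff_simple_of_ne b (α := ⟨i, hi⟩) (by rintro rfl; exact hβ hc)
    · left
      intro β hβ
      exact coeff_simple_of_ne b (α := ⟨i, hi⟩) (by rintro rfl; exact hc hβ)
  · intro i j k hk ⟨hi, ih⟩ hj
    lift j to b.support using hj
    have hkc := coeff_add b hk
    have hjnn := (isPos_iff_coeff_nonneg b j).mp (b.isPos_of_mem_support j.2)
    refine ⟨fun β ↦ by rw [hkc]; have := hi β; have := hjnn β; omega, fun hkζ ↦ ?_⟩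
    have hkζ' := hkc ζ
    have hiζ0 := hi ζ
    have hjζ0 := hjnn ζ
    have hiζ : coeff b i ζ = 0 := by omega
    have hjζ : j ≠ ζ := by
      rintro rfl
      rw [coeff_simple_self] at hkζ'
      omega
    -- a summand on the other side of the partition would be orthogonal to `j`
    have horth : coeff b i j = 0 → ∃ β, coeff b i β ≠ 0 ∧ β ≠ ζ ∧ β ≠ j ∧ (dynkin b).Adj β j := by
      intro hij
      have hne := pairingIn_ne_zero_of_add_simple hk hi hij
      by_contra! hcon
      apply hne
      rw [pairingIn_eq_sum_coeff]
      refine Finset.sum_eq_zero fun β _ ↦ ?_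
      by_cases hβ : coeff b i β = 0
      · rw [hβ, zero_mul]
      · have hβζ : β ≠ ζ := by rintro rfl; exact hβ hiζ
        have hβj : β ≠ j := by rintro rfl; exact hβ hij
        rw [pairingIn_simple_eq_zero hβj (hcon β hβ hβζ hβj), mul_zero]
    by_cases hjc : j ∈ component b ζ α
    · right
      have hside : ∀ β ∉ component b ζ α, coeff b i β = 0 := by
        rcases ih hiζ with ih | ih
        · obtain ⟨β, hβ, hβζ, -, hadj⟩ := horth (ih j hjc)
          exact absurd (ih β (mem_component_of_adj hjc hβζ hadj.symm)) hβ
        · exact ih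
      intro β hβ
      rw [hkc, hside β hβ, coeff_simple_of_ne b (by rintro rfl; exact hβ hjc), add_zero]
    · left
      have hside : ∀ β ∈ component b ζ α, coeff b i β = 0 := by
        rcases ih hiζ with ih | ih
        · exact ih
        · obtain ⟨β, hβ, hβζ, -, hadj⟩ := horth (ih j hjc)
          refine absurd (ih β fun hβc ↦ hjc (mem_component_of_adj hβc hjζ hadj)) hβ
      intro β hβ
      rw [hkc, hside β hβ, coeff_simple_of_ne b (by rintro rfl; exact hjc hβ), add_zero]

end Component

/-! ### Monge roots -/

/-- The combinatorial form of the Monge condition on `𝔤 (-1)`, up to the sign of the roots: `ζ` is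
a root of relative height one, no two other roots of height one add up to a root, and all of them
can be added to `ζ`. -/
def IsMongeRoot (b : (rootSystem H).Base) (S : Finset b.support) (ζ : H.root) : Prop :=
  heightRel b S ζ = 1 ∧
  (∀ γ δ : H.root, heightRel b S γ = 1 → heightRel b S δ = 1 → γ ≠ ζ → δ ≠ ζ →
    (rootSystem H).root γ + (rootSystem H).root δ ∉ Set.range (rootSystem H).root) ∧
  (∀ γ : H.root, heightRel b S γ = 1 → γ ≠ ζ →
    (rootSystem H).root ζ + (rootSystem H).root γ ∈ Set.range (rootSystem H).root)

section DiagramToRoots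

variable {b : (rootSystem H).Base} {S : Finset b.support} {ζ : b.support}

/-- If `S` contains `ζ` and its neighbours, then `ζ` does not occur in any other root of height
one: the reflection in `ζ` would otherwise turn it into a root with coefficients of both signs. -/
lemma coeff_eq_zero_of_heightRel_eq_one_of_ne (hζ : ζ ∈ S)
    (hadj : ∀ α : b.support, α ≠ ζ → (α ∈ S ↔ (dynkin b).Adj ζ α))
    {γ : H.root} (hγ : heightRel b S γ = 1) (hne : γ ≠ ζ) : coeff b γ ζ = 0 := by
  have hnn := coeff_nonneg_of_heightRel_pos (b := b) (S := S) (γ := γ) (by omega)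
  by_contra h0
  have hpos : 0 < coeff b γ ζ := lt_of_le_of_ne (hnn ζ) (Ne.symm h0)
  have hother : ∀ α ∈ S, α ≠ ζ → coeff b γ α = 0 := fun α hα hαζ ↦
    coeff_eq_zero_of_heightRel_eq_one hγ hζ hα hαζ.symm hpos
  have hone : coeff b γ ζ = 1 := by
    rw [← hγ, heightRel, Finset.sum_eq_single_of_mem ζ hζ hother]
  have hpair : (rootSystem H).pairingIn ℤ γ ζ = 2 := by
    rw [pairingIn_eq_sum_coeff (b := b), Finset.sum_eq_single ζ]
    · simp [hone]
    · intro β _ hβ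
      by_cases hβS : β ∈ S
      · rw [hother β hβS hβ, zero_mul]
      · rw [pairingIn_simple_eq_zero hβ fun h ↦ hβS ((hadj β hβ).mpr h.symm), mul_zero]
    · simp
  have hrefl : (rootSystem H).root ((rootSystem H).reflectionPerm ζ γ) =
      (rootSystem H).root γ - (2 : ℤ) • (rootSystem H).root ζ := by
    rw [RootPairing.root_reflectionPerm, RootPairing.reflection_apply_root' ℤ, hpair]
  have hcoeff := coeff_sub_zsmul b hrefl
  have hneg := coeff_nonpos_of_neg b (α := ζ) (by rw [hcoeff, coeff_simple_self, hone]; norm_num)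
  refine hne (eq_of_coeff_eq b fun α ↦ ?_)
  by_cases hα : α = ζ
  · rw [hα, hone, coeff_simple_self]
  · have h1 := hneg α
    rw [hcoeff, coeff_simple_of_ne b (Ne.symm hα)] at h1
    rw [coeff_simple_of_ne b (Ne.symm hα)]
    have := hnn α
    omega

lemma pairingIn_neg_of_heightRel_eq_one (hζ : ζ ∈ S)
    (hadj : ∀ α : b.support, α ≠ ζ → (α ∈ S ↔ (dynkin b).Adj ζ α))
    {γ : H.root} (hγ : heightRel b S γ = 1) (hne : γ ≠ ζ) :
    (rootSystem H).pairingIn ℤ γ ζ < 0 := by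
  have hγζ := coeff_eq_zero_of_heightRel_eq_one_of_ne hζ hadj hγ hne
  have hnn := coeff_nonneg_of_heightRel_pos (b := b) (S := S) (γ := γ) (by omega)
  obtain ⟨α, hα, hpos⟩ := exists_coeff_pos_of_heightRel_pos (b := b) (S := S) (γ := γ) (by omega)
  have hαζ : α ≠ ζ := by rintro rfl; omega
  rw [pairingIn_eq_sum_coeff (b := b)]
  refine Finset.sum_neg' (fun β _ ↦ ?_) ⟨α, Finset.mem_univ _, ?_⟩
  · by_cases hβ : β = ζ
    · rw [hβ, hγζ, zero_mul]
    · exact mul_nonpos_of_nonneg_of_nonpos (hnn β)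
        (b.pairingIn_le_zero_of_ne (fun h ↦ hβ (Subtype.ext h)) β.2 ζ.2)
  · exact mul_neg_of_pos_of_neg hpos (pairingIn_simple_neg_of_adj ((hadj α hαζ).mp hα).symm)

/-- The conditions on the Dynkin diagram make `ζ` a Monge root. Two roots of height one different
from `ζ` contain neighbours `α`, `α'` of `ζ`. Their sum is not a root: if `α = α'`, it would be a
root of the component of `α` with coefficient two at `α`, and if `α ≠ α'`, it would close a cycle
through `ζ`. -/
theorem isMongeRoot_of_dynkin (hζ : ζ ∈ S)
    (hadj : ∀ α : b.support, α ≠ ζ → (α ∈ S ↔ (dynkin b).Adj ζ α))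
    (hcomp : ∀ α ∈ S, α ≠ ζ → ∀ γ ∈ subdiagramRoots b (component b ζ α), coeff b γ α ≤ 1) :
    IsMongeRoot b S ζ := by
  have hsum : ∀ γ : H.root, heightRel b S γ = 1 → γ ≠ ζ →
      (rootSystem H).root γ + (rootSystem H).root ζ ∈ Set.range (rootSystem H).root := by
    intro γ hγ hne
    refine (rootSystem H).root_add_root_mem_of_pairingIn_neg
      (pairingIn_neg_of_heightRel_eq_one hζ hadj hγ hne) fun h ↦ ?_
    have := coeff_neg b h ζ
    rw [coeff_eq_zero_of_heightRel_eq_one_of_ne hζ hadj hγ hne, coeff_simple_self] at this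
    omega
  refine ⟨heightRel_simple_of_mem b hζ, ?_, fun γ hγ hne ↦ by rw [add_comm]; exact hsum γ hγ hne⟩
  rintro γ δ hγ hδ hγne hδne ⟨ρ, hρ⟩
  have hγζ := coeff_eq_zero_of_heightRel_eq_one_of_ne hζ hadj hγ hγne
  have hδζ := coeff_eq_zero_of_heightRel_eq_one_of_ne hζ hadj hδ hδne
  have hγnn := coeff_nonneg_of_heightRel_pos (b := b) (S := S) (γ := γ) (by omega)
  have hδnn := coeff_nonneg_of_heightRel_pos (b := b) (S := S) (γ := δ) (by omega)
  have hρc := coeff_add b hρ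
  have hρζ : coeff b ρ ζ = 0 := by rw [hρc]; omega
  obtain ⟨α, hα, hγα⟩ :=
    exists_coeff_pos_of_heightRel_pos (b := b) (S := S) (γ := γ) (by omega)
  obtain ⟨α', hα', hδα'⟩ :=
    exists_coeff_pos_of_heightRel_pos (b := b) (S := S) (γ := δ) (by omega)
  have hαζ : α ≠ ζ := by rintro rfl; omega
  by_cases hαα' : α = α'
  · subst hαα'
    have hρpos : b.IsPos ρ := (isPos_iff_coeff_nonneg b ρ).mpr fun β ↦ by
      rw [hρc]; exact add_nonneg (hγnn β) (hδnn β)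
    have hρα := hρc α
    rcases coeff_eq_zero_or_of_component hρpos hρζ α with h | h
    · have := h α (self_mem_component hαζ)
      omega
    · have := hcomp α hα hαζ ρ h
      omega
  · have hγα' := coeff_eq_zero_of_heightRel_eq_one hγ hα hα' hαα' hγα
    have hδα := coeff_eq_zero_of_heightRel_eq_one hδ hα' hα (Ne.symm hαα') hδα'
    have hγδ : (rootSystem H).pairingIn ℤ γ δ < 0 := by
      refine pairingIn_neg_of_add_mem (by rintro rfl; omega) hρ ?_
      rintro ⟨l, hl⟩
      have hlc := coeff_sub b hl
      have h1 := hlc α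
      have h2 := hlc α'
      have := coeff_nonneg_of_pos b (i := l) (α := α) (by omega) α'
      omega
    obtain ⟨σ, hσ⟩ := hsum γ hγ hγne
    have hσc := coeff_add b hσ ζ
    rw [coeff_simple_self, hγζ] at hσc
    refine false_of_pairwise_obtuse hρ hσ hγδ
      (pairingIn_neg_of_heightRel_eq_one hζ hadj hγ hγne)
      (pairingIn_neg_of_heightRel_eq_one hζ hadj hδ hδne) ?_ ?_ ?_ ?_
    · intro h
      have := congrArg (coeff b · ζ) ((rootSystem H).root.injective h)
      simp only [coeff_simple_self] at this
      omega
    · intro h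
      have := coeff_neg b h ζ
      rw [coeff_simple_self] at this
      omega
    · intro h
      have := congrArg (coeff b · ζ) ((rootSystem H).root.injective h)
      omega
    · intro h
      have := coeff_neg b h ζ
      omega

end DiagramToRoots

/-! ### Root vectors -/

section RootVectors

/-- A nonzero element of the root space of `γ`. -/
def rootVector (γ : H.root) : 𝔤 := γ.1.exists_ne_zero.choose

omit [IsKilling ℂ 𝔤] in
lemma rootVector_mem (γ : H.root) : rootVector γ ∈ rootSpace H γ.1 :=
  γ.1.exists_ne_zero.choose_spec.1

omit [IsKilling ℂ 𝔤] in
lemma rootVector_ne_zero (γ : H.root) : rootVector γ ≠ 0 :=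
  γ.1.exists_ne_zero.choose_spec.2

lemma exists_smul_rootVector {γ : H.root} {x : 𝔤} (hx : x ∈ rootSpace H γ.1) :
    ∃ c : ℂ, c • rootVector γ = x := by
  obtain ⟨c, hc⟩ := (finrank_eq_one_iff_of_nonzero' (⟨rootVector γ, rootVector_mem γ⟩ :
    rootSpace H γ.1) (by simpa using rootVector_ne_zero γ)).mp
      (finrank_rootSpace_eq_one γ.1 (LieSubalgebra.isNonZero_coe_root γ)) ⟨x, hx⟩
  exact ⟨c, congrArg Subtype.val hc⟩

lemma rootSpace_eq_span (γ : H.root) :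
    (rootSpace H γ.1).toSubmodule = Submodule.span ℂ {rootVector γ} := by
  refine le_antisymm (fun x hx ↦ ?_) ?_
  · exact Submodule.mem_span_singleton.mpr (exists_smul_rootVector hx)
  · rw [Submodule.span_singleton_le_iff_mem]
    exact rootVector_mem γ

omit [IsKilling ℂ 𝔤] in
lemma linearIndependent_rootVector :
    LinearIndependent ℂ (rootVector : H.root → 𝔤) := by
  have h := LieModule.iSupIndep_genWeightSpace' ℂ H 𝔤
  rw [← LieSubmodule.iSupIndep_toSubmodule] at h
  exact (h.comp (f := fun γ : H.root ↦ γ.1) Subtype.val_injective).linearIndependent _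
    (fun γ ↦ rootVector_mem γ) rootVector_ne_zero

lemma coe_add_eq {i j k : H.root}
    (h : (rootSystem H).root k = (rootSystem H).root i + (rootSystem H).root j) :
    ((k.1 : Weight ℂ H 𝔤) : H → ℂ) = i.1 + j.1 := by
  funext x
  exact LinearMap.congr_fun h x

lemma lie_rootVector_mem_rootSpace {i j k : H.root}
    (h : (rootSystem H).root k = (rootSystem H).root i + (rootSystem H).root j) :
    ⁅rootVector i, rootVector j⁆ ∈ rootSpace H k.1 := by
  rw [coe_add_eq h]
  exact lie_mem_genWeightSpace_of_mem_genWeightSpace (rootVector_mem i) (rootVector_mem j)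

lemma lie_rootVector_eq_zero {i j : H.root}
    (h : (rootSystem H).root i + (rootSystem H).root j ∉ Set.range (rootSystem H).root)
    (h0 : (rootSystem H).root i + (rootSystem H).root j ≠ 0) :
    ⁅rootVector i, rootVector j⁆ = 0 := by
  have hmem := lie_mem_genWeightSpace_of_mem_genWeightSpace (rootVector_mem i) (rootVector_mem j)
  by_contra hne
  let w : Weight ℂ H 𝔤 := ⟨i.1 + j.1, fun hbot ↦ hne (by simpa [hbot] using hmem)⟩
  have hw : w.IsNonZero := by
    intro hw
    apply h0
    ext x
    exact congrFun hw x
  refine h ⟨⟨w, by simpa using hw⟩, ?_⟩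
  ext x
  rfl

/-- The bracket of two root spaces is nonzero whenever it may be. The root vector of `j` is
obtained from a highest vector of the `i`-string through `j` by lowering, and raising undoes
this up to a nonzero scalar. -/
lemma lie_rootVector_ne_zero {i j k : H.root}
    (h : (rootSystem H).root k = (rootSystem H).root i + (rootSystem H).root j) :
    ⁅rootVector i, rootVector j⁆ ≠ 0 := by
  have hα : i.1.IsNonZero := LieSubalgebra.isNonZero_coe_root i
  obtain ⟨x, hx, hx0⟩ := (chainTop i.1 j.1).exists_ne_zero
  obtain ⟨t, e, f, isSl2, he, hf⟩ := exists_isSl2Triple_of_weight_isNonZero hα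
  obtain rfl := isSl2.h_eq_coroot hα he hf
  have prim : isSl2.HasPrimitiveVectorWith x (chainLength i.1 j.1 : ℂ) :=
    have := lie_mem_genWeightSpace_of_mem_genWeightSpace he hx
    ⟨hx0, (chainLength_smul _ _ hx).symm, by
      rwa [LieModule.genWeightSpace_add_chainTop _ _ hα] at this⟩
  obtain ⟨c, hc⟩ := exists_smul_rootVector he
  obtain ⟨n, hn⟩ : ∃ n, chainTopCoeff i.1 j.1 = n + 1 := by
    refine Nat.exists_eq_succ_of_ne_zero fun h0 ↦ ?_
    have := (rootSpace_zsmul_add_ne_bot_iff i.1 j.1 hα 1).mp (by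
      rw [one_zsmul, ← coe_add_eq h]
      exact k.1.genWeightSpace_ne_bot)
    omega
  have hle := chainTopCoeff_le_chainLength i.1 j.1
  have hy : ((toEnd ℂ 𝔤 𝔤 f) ^ (n + 1)) x ∈ rootSpace H j.1 := by
    have h1 := toEnd_pow_apply_mem hf hx (n + 1)
    convert h1 using 2
    rw [coe_chainTop', hn]
    simp
  obtain ⟨d, hd⟩ := exists_smul_rootVector hy
  intro hzero
  have key := prim.lie_e_pow_succ_toEnd_f n
  rw [← hd, ← hc, smul_lie, lie_smul, hzero, smul_zero, smul_zero, eq_comm, smul_eq_zero] at key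
  rcases key with key | key
  · have h2 : (chainLength i.1 j.1 : ℂ) = n := by
      rcases mul_eq_zero.mp key with h2 | h2
      · exact absurd h2 (by norm_cast)
      · exact sub_eq_zero.mp h2
    have h3 : chainLength i.1 j.1 = n := by exact_mod_cast h2
    omega
  · exact prim.pow_toEnd_f_ne_zero_of_eq_nat rfl (by omega) key

lemma exists_lie_rootVector_eq {i j k : H.root}
    (h : (rootSystem H).root k = (rootSystem H).root i + (rootSystem H).root j) :
    ∃ c : ℂ, c ≠ 0 ∧ ⁅rootVector i, rootVector j⁆ = c • rootVector k := by
  obtain ⟨c, hc⟩ := exists_smul_rootVector (lie_rootVector_mem_rootSpace h)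
  refine ⟨c, ?_, hc.symm⟩
  rintro rfl
  exact lie_rootVector_ne_zero h (by rw [← hc, zero_smul])

omit [IsKilling ℂ 𝔤] in
lemma rootVector_notMem_span {T : Set H.root} {ρ : H.root} (h : ρ ∉ T) :
    rootVector ρ ∉ Submodule.span ℂ (rootVector '' T) :=
  linearIndependent_rootVector.notMem_span_image h

/-- Brackets of root vectors lie in the span of the root vectors of the sum. -/
lemma lie_rootVector_mem_span {i j : H.root}
    (h0 : (rootSystem H).root i + (rootSystem H).root j ≠ 0) {T : Set H.root}
    (hT : ∀ ρ, (rootSystem H).root ρ = (rootSystem H).root i + (rootSystem H).root j → ρ ∈ T) :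
    ⁅rootVector i, rootVector j⁆ ∈ Submodule.span ℂ (rootVector '' T) := by
  by_cases h : (rootSystem H).root i + (rootSystem H).root j ∈ Set.range (rootSystem H).root
  · obtain ⟨ρ, hρ⟩ := h
    obtain ⟨c, -, hc⟩ := exists_lie_rootVector_eq hρ
    rw [hc]
    exact Submodule.smul_mem _ _ (Submodule.subset_span ⟨ρ, hT ρ hρ, rfl⟩)
  · rw [lie_rootVector_eq_zero h h0]
    exact Submodule.zero_mem _

lemma iSup_rootSpace_eq_span (T : Set H.root) :
    ⨆ γ ∈ T, (rootSpace H γ.1).toSubmodule = Submodule.span ℂ (rootVector '' T) := by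
  simp_rw [rootSpace_eq_span]
  rw [Submodule.span_eq_iSup_of_singleton_spans, iSup_image]

end RootVectors

/-! ### Graded pieces -/

/-- If each `s i` lies in the member `t i` of an independent family, then an element of `t i` that
is a sum of elements of the `s j` is an element of `s i`. -/
lemma mem_of_mem_iSup_of_iSupIndep {ι V : Type*} [AddCommGroup V] [Module ℂ V]
    {s t : ι → Submodule ℂ V} (ht : iSupIndep t) (hst : ∀ i, s i ≤ t i) {i : ι} {x : V}
    (hx : x ∈ ⨆ j, s j) (hxi : x ∈ t i) : x ∈ s i := by
  rw [iSup_split_single s i, Submodule.mem_sup] at hx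
  obtain ⟨y, hy, z, hz, rfl⟩ := hx
  have hz' : z ∈ t i := by simpa using Submodule.sub_mem _ hxi (hst i hy)
  have hz'' : z ∈ ⨆ (j) (_ : j ≠ i), t j := iSup₂_mono (fun j _ ↦ hst j) hz
  have : z = 0 := (Submodule.disjoint_def.mp (ht i)) z hz' hz''
  rwa [this, add_zero]

lemma iSupIndep_eigenspace_intCast {V : Type*} [AddCommGroup V] [Module ℂ V]
    (D : Module.End ℂ V) : iSupIndep fun j : ℤ ↦ D.eigenspace (j : ℂ) :=
  D.eigenspaces_iSupIndep.comp (f := fun j : ℤ ↦ (j : ℂ)) Int.cast_injective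

section GradedPiece

variable (b : (rootSystem H).Base) (S : Finset b.support)

/-- There is a grading element: an element of the Cartan subalgebra on which every root takes its
relative height as value. -/
lemma exists_gradingElement :
    ∃ h : H, ∀ γ : H.root, (γ.1 : Weight ℂ H 𝔤) h = (heightRel b S γ : ℂ) := by
  obtain ⟨h, hh⟩ := (Module.evalEquiv ℂ H).surjective (∑ α ∈ S, b.toWeightBasis.coord α)
  have hh' : ∀ f : Module.Dual ℂ H, f h = ∑ α ∈ S, b.toWeightBasis.coord α f := fun f ↦ by
    have := LinearMap.congr_fun hh f
    rw [LinearMap.sum_apply] at this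
    exact this
  refine ⟨h, fun γ ↦ ?_⟩
  have hγ : ∀ α, b.toWeightBasis.coord α ((rootSystem H).root γ) = (coeff b γ α : ℂ) := by
    intro α
    rw [root_eq_sum_coeff b γ, map_sum, Finset.sum_eq_single α]
    · rw [map_zsmul, ← b.toWeightBasis_apply, Module.Basis.coord_apply, Module.Basis.repr_self]
      simp
    · intro β _ hβ
      rw [map_zsmul, ← b.toWeightBasis_apply, Module.Basis.coord_apply, Module.Basis.repr_self]
      simp [hβ]
    · simp
  refine (hh' ((rootSystem H).root γ)).trans ?_
  rw [Finset.sum_congr rfl fun α _ ↦ hγ α, heightRel, Int.cast_sum]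

lemma gradedPiece_eq (𝔱 : Submodule ℂ 𝔤) (R : Set H.root) (j : ℤ) :
    gradedPiece b 𝔱 R S j = (if j = 0 then 𝔱 else ⊥) ⊔
      Submodule.span ℂ (rootVector '' {γ | γ ∈ R ∧ heightRel b S γ = j}) := by
  rw [← iSup_rootSpace_eq_span]
  rfl

lemma gradedPiece_of_ne_zero (𝔱 : Submodule ℂ 𝔤) (R : Set H.root) {j : ℤ} (hj : j ≠ 0) :
    gradedPiece b 𝔱 R S j =
      Submodule.span ℂ (rootVector '' {γ | γ ∈ R ∧ heightRel b S γ = j}) := by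
  rw [gradedPiece_eq, if_neg hj, bot_sup_eq]

variable {S} in
lemma rootVector_mem_gradedPiece (𝔱 : Submodule ℂ 𝔤) {R : Set H.root} {j : ℤ} {γ : H.root}
    (hγ : γ ∈ R) (hj : heightRel b S γ = j) : rootVector γ ∈ gradedPiece b 𝔱 R S j := by
  rw [gradedPiece_eq]
  exact Submodule.mem_sup_right (Submodule.subset_span ⟨γ, ⟨hγ, hj⟩, rfl⟩)

lemma iSup_gradedPiece (𝔱 : Submodule ℂ 𝔤) (R : Set H.root) :
    ⨆ j, gradedPiece b 𝔱 R S j = 𝔱 ⊔ Submodule.span ℂ (rootVector '' R) := by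
  apply le_antisymm
  · refine iSup_le fun j ↦ ?_
    rw [gradedPiece_eq]
    refine sup_le_sup ?_ (Submodule.span_mono (Set.image_mono fun γ hγ ↦ hγ.1))
    split_ifs
    · exact le_rfl
    · exact bot_le
  · refine sup_le ?_ (Submodule.span_le.mpr ?_)
    · refine le_trans ?_ (le_iSup _ 0)
      rw [gradedPiece_eq, if_pos rfl]
      exact le_sup_left
    · rintro _ ⟨γ, hγ, rfl⟩
      exact Submodule.mem_iSup_of_mem _ (rootVector_mem_gradedPiece b 𝔱 hγ rfl)

variable {b S} in
lemma gradedPiece_le_eigenspace {h : H}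
    (hh : ∀ γ : H.root, (γ.1 : Weight ℂ H 𝔤) h = (heightRel b S γ : ℂ))
    {𝔱 : Submodule ℂ 𝔤} (h𝔱 : 𝔱 ≤ H.toSubmodule) (R : Set H.root) (j : ℤ) :
    gradedPiece b 𝔱 R S j ≤ (LieAlgebra.ad ℂ 𝔤 (h : 𝔤)).eigenspace (j : ℂ) := by
  rw [gradedPiece_eq]
  refine sup_le ?_ (Submodule.span_le.mpr ?_)
  · split_ifs with hj
    · intro x hx
      rw [Module.End.mem_eigenspace_iff, hj, LieAlgebra.ad_apply]
      have := congrArg Subtype.val (trivial_lie_zero H H h ⟨x, h𝔱 hx⟩)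
      simpa using this
    · exact bot_le
  · rintro _ ⟨γ, ⟨-, hγ⟩, rfl⟩
    rw [SetLike.mem_coe, Module.End.mem_eigenspace_iff, LieAlgebra.ad_apply, ← hγ, ← hh]
    exact lie_eq_smul_of_mem_rootSpace (rootVector_mem γ) h

lemma iSupIndep_gradedPiece {𝔱 : Submodule ℂ 𝔤} (h𝔱 : 𝔱 ≤ H.toSubmodule) (R : Set H.root) :
    iSupIndep (gradedPiece b 𝔱 R S) := by
  obtain ⟨h, hh⟩ := exists_gradingElement b S
  exact (iSupIndep_eigenspace_intCast _).mono fun j ↦ gradedPiece_le_eigenspace hh h𝔱 R j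

lemma lie_mem_gradedPiece {𝔱 : Submodule ℂ 𝔤} (h𝔱 : 𝔱 ≤ H.toSubmodule) (R : Set H.root)
    {i j : ℤ} {x y : 𝔤} (hx : x ∈ gradedPiece b 𝔱 R S i) (hy : y ∈ gradedPiece b 𝔱 R S j)
    (hxy : ⁅x, y⁆ ∈ ⨆ k, gradedPiece b 𝔱 R S k) :
    ⁅x, y⁆ ∈ gradedPiece b 𝔱 R S (i + j) := by
  obtain ⟨h, hh⟩ := exists_gradingElement b S
  have hle := gradedPiece_le_eigenspace hh h𝔱 R
  refine mem_of_mem_iSup_of_iSupIndep (iSupIndep_eigenspace_intCast _) hle hxy ?_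
  have h1 := Module.End.mem_eigenspace_iff.mp (hle i hx)
  have h2 := Module.End.mem_eigenspace_iff.mp (hle j hy)
  rw [LieAlgebra.ad_apply] at h1 h2
  rw [Module.End.mem_eigenspace_iff, LieAlgebra.ad_apply, leibniz_lie, h1, h2, smul_lie, lie_smul,
    Int.cast_add, add_smul]

end GradedPiece

/-! ### The grading of `𝔤` -/

section Grading

variable (b : (rootSystem H).Base) (S : Finset b.support)

lemma cartan_sup_span_rootVector :
    H.toSubmodule ⊔ Submodule.span ℂ (rootVector '' (Set.univ : Set H.root)) = ⊤ := by
  have h := congrArg LieSubmodule.toSubmodule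
    (cartan_sup_iSup_rootSpace_eq_top (K := ℂ) (L := 𝔤) H)
  rw [LieSubmodule.sup_toSubmodule, LieSubmodule.top_toSubmodule,
    LieSubmodule.iSup_toSubmodule] at h
  rw [← iSup_rootSpace_eq_span, eq_top_iff, ← h]
  refine sup_le_sup le_rfl (iSup_le fun α ↦ ?_)
  rw [LieSubmodule.iSup_toSubmodule]
  exact iSup_le fun hα ↦ le_iSup₂_of_le (⟨α, by simpa using hα⟩ : H.root) trivial le_rfl

lemma iSup_grading : ⨆ j, grading b S j = ⊤ :=
  (iSup_gradedPiece b S _ _).trans cartan_sup_span_rootVector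

lemma lie_mem_grading {i j : ℤ} {x y : 𝔤} (hx : x ∈ grading b S i) (hy : y ∈ grading b S j) :
    ⁅x, y⁆ ∈ grading b S (i + j) :=
  lie_mem_gradedPiece b S le_rfl _ hx hy (by
    change _ ∈ ⨆ j, grading b S j
    rw [iSup_grading]; trivial)

lemma grading_of_ne_zero {j : ℤ} (hj : j ≠ 0) :
    grading b S j = Submodule.span ℂ (rootVector '' {γ | heightRel b S γ = j}) := by
  rw [grading, gradedPiece_of_ne_zero b S _ _ hj]
  simp

omit [IsKilling ℂ 𝔤] in
lemma finrank_span_rootVector (T : Set H.root) :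
    Module.finrank ℂ (Submodule.span ℂ (rootVector '' T)) = T.ncard := by
  have : Fintype T := Fintype.ofFinite T
  rw [Set.image_eq_range, ← Nat.card_coe_set_eq, Nat.card_eq_fintype_card]
  exact finrank_span_eq_card
    (linearIndependent_rootVector.comp (fun γ : T ↦ γ.1) Subtype.val_injective)

/-- The negative part of the grading is generated by its component of degree `-1`. A negative root
of height `j - 1` is the sum of a negative root and `-α` for a simple root `α`. If `α` has height
one, this is a sum of roots of height `j` and `-1`. If `α` has height zero, then bracketing with
the root vector of `-α` preserves `[𝔤 (-1), 𝔤 j]`. -/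
lemma span_lie_grading {j : ℤ} (hj : j < 0) :
    Submodule.span ℂ {z : 𝔤 | ∃ x ∈ grading b S (-1), ∃ y ∈ grading b S j, ⁅x, y⁆ = z} =
      grading b S (j - 1) := by
  set W := Submodule.span ℂ {z : 𝔤 | ∃ x ∈ grading b S (-1), ∃ y ∈ grading b S j, ⁅x, y⁆ = z}
    with hW
  apply le_antisymm
  · refine Submodule.span_le.mpr ?_
    rintro _ ⟨x, hx, y, hy, rfl⟩
    rw [sub_eq_neg_add]
    exact lie_mem_grading b S hx hy
  · have hstable : ∀ x ∈ grading b S 0, ∀ w ∈ W, ⁅x, w⁆ ∈ W := by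
      intro x hx w hw
      induction hw using Submodule.span_induction with
      | mem w hw =>
        obtain ⟨y, hy, z, hz, rfl⟩ := hw
        rw [leibniz_lie]
        refine Submodule.add_mem _ (Submodule.subset_span ⟨_, ?_, z, hz, rfl⟩)
          (Submodule.subset_span ⟨y, hy, _, ?_, rfl⟩)
        · simpa using lie_mem_grading b S hx hy
        · simpa using lie_mem_grading b S hx hz
      | zero => simp
      | add u v _ _ hu hv => rw [lie_add]; exact W.add_mem hu hv
      | smul c u _ hu => rw [lie_smul]; exact W.smul_mem c hu
    have hpos : ∀ γ : H.root, b.IsPos γ → heightRel b S (negRoot γ) = j - 1 →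
        rootVector (negRoot γ) ∈ W := by
      intro γ hγ
      refine hγ.induction_on_add (p := fun γ ↦ heightRel b S (negRoot γ) = j - 1 →
        rootVector (negRoot γ) ∈ W) ?_ ?_
      · intro i hi hh
        lift i to b.support using hi
        rw [heightRel_negRoot] at hh
        by_cases hiS : i ∈ S
        · rw [heightRel_simple_of_mem b hiS] at hh
          omega
        · rw [heightRel_simple_of_notMem b hiS] at hh
          omega
      · intro i a k hk ih ha hh
        lift a to b.support using ha
        have hk' : (rootSystem H).root (negRoot k) =
            (rootSystem H).root (negRoot a) + (rootSystem H).root (negRoot i) := by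
          rw [root_negRoot, hk, root_negRoot, root_negRoot]
          abel
        obtain ⟨c, hc0, hc⟩ := exists_lie_rootVector_eq hk'
        have hadd := heightRel_add b S hk'
        suffices ⁅rootVector (negRoot a.1), rootVector (negRoot i)⁆ ∈ W by
          rw [hc] at this
          exact (W.smul_mem_iff hc0).mp this
        by_cases haS : a ∈ S
        · have hha : heightRel b S (negRoot a) = -1 := by
            rw [heightRel_negRoot, heightRel_simple_of_mem b haS]
          exact Submodule.subset_span ⟨_, rootVector_mem_gradedPiece b _ trivial hha, _,
            rootVector_mem_gradedPiece b _ trivial (by omega), rfl⟩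
        · have hha : heightRel b S (negRoot a) = 0 := by
            rw [heightRel_negRoot, heightRel_simple_of_notMem b haS, neg_zero]
          exact hstable _ (rootVector_mem_gradedPiece b _ trivial hha) _ (ih (by omega))
    rw [grading_of_ne_zero b S (by omega : j - 1 ≠ 0), Submodule.span_le]
    rintro _ ⟨γ, hγ, rfl⟩
    have := hpos (negRoot γ)
    rw [negRoot_negRoot] at this
    refine this ?_ hγ
    rw [isPos_iff_coeff_nonneg]
    exact coeff_nonneg_of_heightRel_pos (b := b) (S := S) (by
      rw [heightRel_negRoot, show heightRel b S γ = j - 1 from hγ]; omega)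

lemma isDepthGrading_grading (h1 : grading b S (-1) ≠ ⊥) :
    ∃ k : ℕ, IsDepthGrading k (grading b S) := by
  have hne : Nonempty H.root := by
    by_contra hcon
    rw [not_nonempty_iff] at hcon
    apply h1
    rw [grading_of_ne_zero b S (by norm_num), Set.eq_empty_of_isEmpty
      {γ | heightRel b S γ = -1}]
    simp
  obtain ⟨γ, -, hγ⟩ := Finset.exists_max_image (Finset.univ : Finset H.root)
    (fun γ ↦ (heightRel b S γ).natAbs) Finset.univ_nonempty
  have hmem : ∀ δ : H.root, grading b S (heightRel b S δ) ≠ ⊥ := fun δ hbot ↦ by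
    have := rootVector_mem_gradedPiece b H.toSubmodule (Set.mem_univ δ) (S := S) rfl
    change _ ∈ grading b S _ at this
    rw [hbot] at this
    exact rootVector_ne_zero δ this
  have hmem' : grading b S (-heightRel b S γ) ≠ ⊥ := by
    rw [← heightRel_negRoot]
    exact hmem _
  refine ⟨(heightRel b S γ).natAbs, ?_, ?_, fun i j x y hx hy ↦ lie_mem_grading b S hx hy,
    fun j hj ↦ span_lie_grading b S hj, ?_, ?_⟩
  · exact DirectSum.isInternal_submodule_of_iSupIndep_of_iSup_eq_top
      (iSupIndep_gradedPiece b S le_rfl _) (iSup_grading b S)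
  · intro j hj
    rw [Int.abs_eq_natAbs] at hj
    rw [grading_of_ne_zero b S (by omega)]
    have : {γ : H.root | heightRel b S γ = j} = ∅ := by
      ext δ
      have := hγ δ (Finset.mem_univ _)
      simp only [Set.mem_ofPred_eq, Set.mem_empty_iff_false, iff_false]
      omega
    rw [this]
    simp
  · rcases Int.natAbs_eq (heightRel b S γ) with h | h
    · rw [← h]; exact hmem γ
    · rw [← neg_eq_iff_eq_neg.mpr h]; exact hmem'
  · rcases Int.natAbs_eq (heightRel b S γ) with h | h
    · rw [← h]; exact hmem'
    · rw [← h]; exact hmem γ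

/-- Every root of height at least two is a sum of a root of height one and another root. -/
lemma exists_add_of_two_le_heightRel {ρ : H.root} (hρ : 2 ≤ heightRel b S ρ) :
    ∃ γ δ : H.root, heightRel b S γ = 1 ∧ heightRel b S δ = heightRel b S ρ - 1 ∧
      (rootSystem H).root ρ = (rootSystem H).root γ + (rootSystem H).root δ := by
  set j := 1 - heightRel b S ρ with hj
  have hgen := span_lie_grading b S (j := j) (by omega)
  rw [grading_of_ne_zero b S (by norm_num : (-1 : ℤ) ≠ 0),
    grading_of_ne_zero b S (by omega : j ≠ 0)] at hgen
  by_contra! hcon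
  have hmem : rootVector (negRoot ρ) ∈ grading b S (j - 1) :=
    rootVector_mem_gradedPiece b _ trivial (by rw [heightRel_negRoot]; omega)
  rw [← hgen] at hmem
  refine rootVector_notMem_span (T := {negRoot ρ}ᶜ) (by simp) (Submodule.span_le.mpr ?_ hmem)
  rintro _ ⟨x, hx, y, hy, rfl⟩
  have key : ∀ γ δ : H.root, heightRel b S γ = -1 → heightRel b S δ = j →
      ⁅rootVector γ, rootVector δ⁆ ∈
        Submodule.span ℂ (rootVector '' ({negRoot ρ}ᶜ : Set H.root)) := by
    intro γ δ hγ hδ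
    refine lie_rootVector_mem_span (root_add_ne_zero_of_heightRel b S (by omega)) ?_
    rintro σ hσ rfl
    refine hcon (negRoot γ) (negRoot δ) (by simp [hγ]) (by rw [heightRel_negRoot]; omega) ?_
    rw [root_negRoot, root_negRoot, ← neg_add, ← hσ, root_negRoot, neg_neg]
  induction hx, hy using Submodule.span_induction₂ with
  | mem_mem x y hx hy =>
    obtain ⟨γ, hγ, rfl⟩ := hx
    obtain ⟨δ, hδ, rfl⟩ := hy
    exact key γ δ hγ hδ
  | zero_left y => simp
  | zero_right x => simp
  | add_left x y z _ _ _ h1 h2 => rw [add_lie]; exact Submodule.add_mem _ h1 h2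
  | add_right x y z _ _ _ h1 h2 => rw [lie_add]; exact Submodule.add_mem _ h1 h2
  | smul_left r x y _ _ h => rw [smul_lie]; exact Submodule.smul_mem _ r h
  | smul_right r x y _ _ h => rw [lie_smul]; exact Submodule.smul_mem _ r h

end Grading

/-! ### Gradings of Monge type and Monge roots -/

section MongeType

variable {b : (rootSystem H).Base} {S : Finset b.support}

lemma ncard_heightRel_neg (b : (rootSystem H).Base) (S : Finset b.support) (j : ℤ) :
    {γ : H.root | heightRel b S γ = -j}.ncard = {γ : H.root | heightRel b S γ = j}.ncard := by
  rw [← Set.ncard_image_of_injective {γ : H.root | heightRel b S γ = j} negRoot_injective]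
  congr 1
  ext γ
  constructor
  · intro h
    exact ⟨negRoot γ, by simpa [neg_eq_iff_eq_neg] using h, negRoot_negRoot γ⟩
  · rintro ⟨δ, hδ, rfl⟩
    simpa using hδ

lemma finrank_grading_neg (b : (rootSystem H).Base) (S : Finset b.support) {j : ℤ} (hj : 0 < j) :
    Module.finrank ℂ (grading b S (-j)) = {γ : H.root | heightRel b S γ = j}.ncard := by
  rw [grading_of_ne_zero b S (by omega), finrank_span_rootVector, ncard_heightRel_neg]

/-- If no two roots of height one different from `ζ` add up to a root, then the roots of height two
are the roots `ζ + γ`. -/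
lemma ncard_heightRel_two {ζ : H.root} (hζ : heightRel b S ζ = 1)
    (hno : ∀ γ δ : H.root, heightRel b S γ = 1 → heightRel b S δ = 1 → γ ≠ ζ → δ ≠ ζ →
      (rootSystem H).root γ + (rootSystem H).root δ ∉ Set.range (rootSystem H).root) :
    {ρ : H.root | heightRel b S ρ = 2}.ncard =
      {γ : H.root | heightRel b S γ = 1 ∧ γ ≠ ζ ∧
        (rootSystem H).root ζ + (rootSystem H).root γ ∈ Set.range (rootSystem H).root}.ncard := by
  rw [← Set.ncard_image_of_injective _ (rootSystem H).root.injective,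
    ← Set.ncard_image_of_injective {γ : H.root | _}
      ((add_right_injective ((rootSystem H).root ζ)).comp (rootSystem H).root.injective)]
  congr 1
  ext x
  constructor
  · rintro ⟨ρ, hρ, rfl⟩
    rw [Set.mem_ofPred_eq] at hρ
    obtain ⟨γ, δ, hγ, hδ, h⟩ := exists_add_of_two_le_heightRel b S (ρ := ρ) (by omega)
    rw [hρ] at hδ
    have hmem : (rootSystem H).root γ + (rootSystem H).root δ ∈ Set.range (rootSystem H).root :=
      ⟨ρ, h⟩
    by_cases hγζ : γ = ζ
    · subst hγζ
      refine ⟨δ, ⟨by omega, ?_, hmem⟩, h.symm⟩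
      rintro rfl
      rw [← two_nsmul] at hmem
      have : IsAddTorsionFree (Module.Dual ℂ H) := .of_isTorsionFree ℂ _
      exact (rootSystem H).nsmul_notMem_range_root hmem
    · by_cases hδζ : δ = ζ
      · subst hδζ
        rw [add_comm] at hmem h
        exact ⟨γ, ⟨hγ, hγζ, hmem⟩, h.symm⟩
      · exact absurd hmem (hno γ δ hγ (by omega) hγζ hδζ)
  · rintro ⟨γ, ⟨hγ, hne, ρ, hρ⟩, rfl⟩
    refine ⟨ρ, ?_, hρ⟩
    rw [Set.mem_ofPred_eq, heightRel_add b S hρ, hζ, hγ]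
    rfl

/-- The abelian subalgebra `𝔶` need not be a sum of root spaces. If the root vector `e γ₀` of some
root `γ₀` of height `-1` is not in `𝔶`, then `𝔶` contains a vector `e γ + c • e γ₀` for every other
root `γ` of height `-1`. The component of weight `γ + δ` of the bracket of two such vectors is
`⁅e γ, e δ⁆`. Hence all these brackets vanish, and the dimension of `𝔤 (-2)` forces all the brackets
`⁅e γ₀, e γ⁆` to be nonzero. -/
theorem exists_isMongeRoot_of_isMongeType (h : IsMongeType (grading b S)) :
    ∃ ζ : H.root, IsMongeRoot b S ζ := by
  obtain ⟨-, 𝔶, hle, hab, -, hcodim, hdim⟩ := h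
  obtain ⟨γ₀, hγ₀, hγ₀𝔶⟩ : ∃ γ₀ : H.root, heightRel b S γ₀ = -1 ∧ rootVector γ₀ ∉ 𝔶 := by
    by_contra! hcon
    have : grading b S (-1) ≤ 𝔶.toSubmodule := by
      rw [grading_of_ne_zero b S (by norm_num), Submodule.span_le]
      rintro _ ⟨γ, hγ, rfl⟩
      exact hcon γ hγ
    have := Submodule.finrank_mono this
    change _ ≤ Module.finrank ℂ 𝔶 at this
    omega
  have hsup : 𝔶.toSubmodule ⊔ Submodule.span ℂ {rootVector γ₀} = grading b S (-1) := by
    apply Submodule.eq_of_le_of_finrank_le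
    · refine sup_le hle ?_
      rw [Submodule.span_singleton_le_iff_mem]
      exact rootVector_mem_gradedPiece b _ trivial hγ₀
    · have hlt : 𝔶.toSubmodule < 𝔶.toSubmodule ⊔ Submodule.span ℂ {rootVector γ₀} :=
        left_lt_sup.mpr fun hcon ↦ hγ₀𝔶 (hcon (Submodule.mem_span_singleton_self _))
      have := Submodule.finrank_lt_finrank_of_lt hlt
      change Module.finrank ℂ 𝔶 < _ at this
      omega
  have hrep : ∀ γ : H.root, heightRel b S γ = -1 →
      ∃ c : ℂ, rootVector γ + c • rootVector γ₀ ∈ 𝔶 := by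
    intro γ hγ
    have hmem : rootVector γ ∈ grading b S (-1) := rootVector_mem_gradedPiece b _ trivial hγ
    rw [← hsup, Submodule.mem_sup] at hmem
    obtain ⟨y, hy, z, hz, hyz⟩ := hmem
    obtain ⟨c, rfl⟩ := Submodule.mem_span_singleton.mp hz
    refine ⟨-c, ?_⟩
    rw [← hyz]
    simpa using hy
  have hno' : ∀ γ δ : H.root, heightRel b S γ = -1 → heightRel b S δ = -1 → γ ≠ γ₀ → δ ≠ γ₀ →
      (rootSystem H).root γ + (rootSystem H).root δ ∉ Set.range (rootSystem H).root := by
    rintro γ δ hγ hδ hγne hδne ⟨ρ, hρ⟩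
    obtain ⟨c, hc⟩ := hrep γ hγ
    obtain ⟨d, hd⟩ := hrep δ hδ
    have hzero : ⁅rootVector γ + c • rootVector γ₀, rootVector δ + d • rootVector γ₀⁆ = 0 :=
      congrArg Subtype.val (trivial_lie_zero 𝔶 𝔶 ⟨_, hc⟩ ⟨_, hd⟩)
    obtain ⟨k, hk0, hk⟩ := exists_lie_rootVector_eq hρ
    -- the sums `γ + γ₀` and `γ₀ + δ` differ from `ρ = γ + δ`
    have h1 : ⁅rootVector γ, rootVector γ₀⁆ ∈
        Submodule.span ℂ (rootVector '' ({ρ}ᶜ : Set H.root)) := by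
      refine lie_rootVector_mem_span (root_add_ne_zero_of_heightRel b S (by omega)) ?_
      rintro σ hσ rfl
      exact hδne ((rootSystem H).root.injective (add_left_cancel (hρ.symm.trans hσ)))
    have h2 : ⁅rootVector γ₀, rootVector δ⁆ ∈
        Submodule.span ℂ (rootVector '' ({ρ}ᶜ : Set H.root)) := by
      refine lie_rootVector_mem_span (root_add_ne_zero_of_heightRel b S (by omega)) ?_
      rintro σ hσ rfl
      exact hγne ((rootSystem H).root.injective (add_right_cancel (hρ.symm.trans hσ)))
    have hsum : k • rootVector ρ =
        -(d • ⁅rootVector γ, rootVector γ₀⁆ + c • ⁅rootVector γ₀, rootVector δ⁆) := by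
      rw [add_lie, lie_add, lie_add, smul_lie, smul_lie, lie_smul, lie_smul, lie_self, hk] at hzero
      rw [eq_neg_iff_add_eq_zero, ← hzero]
      module
    refine rootVector_notMem_span (ρ := ρ) (T := {ρ}ᶜ) (by simp)
      ((Submodule.smul_mem_iff _ hk0).mp ?_)
    rw [hsum]
    exact Submodule.neg_mem _ (Submodule.add_mem _ (Submodule.smul_mem _ _ h1)
      (Submodule.smul_mem _ _ h2))
  have hζ : heightRel b S (negRoot γ₀) = 1 := by simp [hγ₀]
  have hno : ∀ γ δ : H.root, heightRel b S γ = 1 → heightRel b S δ = 1 → γ ≠ negRoot γ₀ →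
      δ ≠ negRoot γ₀ →
      (rootSystem H).root γ + (rootSystem H).root δ ∉ Set.range (rootSystem H).root := by
    intro γ δ hγ hδ hγne hδne
    rw [← root_negRoot_add_negRoot_mem_iff]
    exact hno' _ _ (by simp [hγ]) (by simp [hδ])
      (fun h ↦ hγne (by rw [← h, negRoot_negRoot])) (fun h ↦ hδne (by rw [← h, negRoot_negRoot]))
  refine ⟨negRoot γ₀, hζ, hno, ?_⟩
  rw [finrank_grading_neg b S (by norm_num : (0 : ℤ) < 1), ← Set.ncard_sdiff_singleton_add_one
    (a := negRoot γ₀) hζ, add_left_inj] at hcodim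
  rw [finrank_grading_neg b S (by norm_num : (0 : ℤ) < 2), ncard_heightRel_two hζ hno,
    ← hcodim] at hdim
  have hsub : {γ : H.root | heightRel b S γ = 1 ∧ γ ≠ negRoot γ₀ ∧
      (rootSystem H).root (negRoot γ₀) + (rootSystem H).root γ ∈ Set.range (rootSystem H).root} ⊆
      {γ : H.root | heightRel b S γ = 1} \ {negRoot γ₀} := fun γ hγ ↦ ⟨hγ.1, hγ.2.1⟩
  have heq := Set.eq_of_subset_of_ncard_le hsub hdim.ge
  intro γ hγ hne
  have : γ ∈ {γ : H.root | heightRel b S γ = 1} \ {negRoot γ₀} := ⟨hγ, hne⟩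
  rw [← heq] at this
  exact this.2.2

/-- The root vectors of the negatives of the roots of height one other than a Monge root span
an abelian subalgebra of codimension one in `𝔤 (-1)`. -/
theorem isMongeType_of_isMongeRoot {ζ : H.root} (h : IsMongeRoot b S ζ)
    (hdim : 1 < Module.finrank ℂ (grading b S (-1))) : IsMongeType (grading b S) := by
  obtain ⟨hζ, hno, hall⟩ := h
  refine ⟨isDepthGrading_grading b S fun hbot ↦ by rw [hbot, finrank_bot] at hdim; omega, ?_⟩
  set T : Set H.root := {γ : H.root | heightRel b S γ = -1} \ {negRoot ζ} with hT
  have hζ' : heightRel b S (negRoot ζ) = -1 := by simp [hζ]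
  have hlie : ∀ x ∈ Submodule.span ℂ (rootVector '' T),
      ∀ y ∈ Submodule.span ℂ (rootVector '' T), ⁅x, y⁆ = 0 := by
    intro x hx y hy
    induction hx, hy using Submodule.span_induction₂ with
    | mem_mem x y hx hy =>
      obtain ⟨γ, ⟨hγ, hγne⟩, rfl⟩ := hx
      obtain ⟨δ, ⟨hδ, hδne⟩, rfl⟩ := hy
      rw [Set.mem_ofPred_eq] at hγ hδ
      refine lie_rootVector_eq_zero ?_ (root_add_ne_zero_of_heightRel b S (by omega))
      rw [← root_negRoot_add_negRoot_mem_iff]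
      exact hno _ _ (by simp [hγ]) (by simp [hδ])
        (fun h ↦ hγne (by rw [← h, negRoot_negRoot]; rfl))
        (fun h ↦ hδne (by rw [← h, negRoot_negRoot]; rfl))
    | zero_left y => simp
    | zero_right x => simp
    | add_left x y z _ _ _ h1 h2 => rw [add_lie, h1, h2, add_zero]
    | add_right x y z _ _ _ h1 h2 => rw [lie_add, h1, h2, add_zero]
    | smul_left r x y _ _ h => rw [smul_lie, h, smul_zero]
    | smul_right r x y _ _ h => rw [lie_smul, h, smul_zero]
  let 𝔶 : LieSubalgebra ℂ 𝔤 :=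
    { Submodule.span ℂ (rootVector '' T) with
      lie_mem' := fun {x y} hx hy ↦ by
        rw [hlie x hx y hy]
        exact Submodule.zero_mem (Submodule.span ℂ (rootVector '' T)) }
  have hfin : Module.finrank ℂ 𝔶 = T.ncard := finrank_span_rootVector T
  have hT1 : T.ncard + 1 = Module.finrank ℂ (grading b S (-1)) := by
    rw [grading_of_ne_zero b S (by norm_num : (-1 : ℤ) ≠ 0), finrank_span_rootVector]
    exact Set.ncard_sdiff_singleton_add_one hζ'
  refine ⟨𝔶, ?_, ?_, ?_, ?_, ?_⟩
  · rw [grading_of_ne_zero b S (by norm_num : (-1 : ℤ) ≠ 0)]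
    exact Submodule.span_mono (Set.image_mono Set.sdiff_subset)
  · exact ⟨fun x y ↦ Subtype.ext (hlie x x.2 y y.2)⟩
  · intro hbot
    have : Module.finrank ℂ 𝔶 = 0 := by
      change Module.finrank ℂ 𝔶.toSubmodule = 0
      rw [hbot, LieSubalgebra.bot_toSubmodule, finrank_bot]
    omega
  · rw [hfin, hT1]
  · have h1 : {γ : H.root | heightRel b S γ = 1}.ncard = T.ncard + 1 := by
      rw [hT1, finrank_grading_neg b S one_pos]
    rw [← Set.ncard_sdiff_singleton_add_one (a := ζ) hζ, add_left_inj] at h1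
    rw [hfin, ← h1, finrank_grading_neg b S two_pos, ncard_heightRel_two hζ hno]
    congr 1
    ext γ
    exact ⟨fun h ↦ ⟨h.1, h.2.1⟩, fun h ↦ ⟨h.1, h.2, hall γ h.1 h.2⟩⟩

end MongeType

/-! ### Monge roots are simple -/

section RootsToDiagram

variable {b : (rootSystem H).Base} {S : Finset b.support} {ζ : H.root}

/-- A Monge root `ζ` and another root `δ` of height one do not differ by a root `β`. Otherwise, for
a third root `γ` of height one, the Jacobi identity for `β`, `γ`, `δ` shows that `β + γ` is a root
whose sum with `δ` is a root, and thus that `β + γ = ζ = β + δ`. -/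
lemma IsMongeRoot.sub_notMem (hζ : IsMongeRoot b S ζ)
    (hcard : 2 < {γ : H.root | heightRel b S γ = 1}.ncard)
    {δ : H.root} (hδ : heightRel b S δ = 1) (hne : δ ≠ ζ) :
    (rootSystem H).root ζ - (rootSystem H).root δ ∉ Set.range (rootSystem H).root := by
  rintro ⟨β, hβ⟩
  obtain ⟨hζ1, hno, hall⟩ := hζ
  have hβ0 : heightRel b S β = 0 := by rw [heightRel_sub b S hβ]; omega
  obtain ⟨γ, hγ, hγmem⟩ : ∃ γ ∈ {γ : H.root | heightRel b S γ = 1}, γ ∉ ({δ, ζ} : Set H.root) :=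
    Set.exists_mem_notMem_of_ncard_lt_ncard (by
      have := Set.ncard_insert_le δ {ζ}
      rw [Set.ncard_singleton] at this
      omega)
  rw [Set.mem_ofPred_eq] at hγ
  simp only [Set.mem_insert_iff, Set.mem_singleton_iff, not_or] at hγmem
  obtain ⟨hγδ, hγζ⟩ := hγmem
  have hβδ : (rootSystem H).root ζ = (rootSystem H).root β + (rootSystem H).root δ := by
    rw [hβ]; abel
  -- as `γ + δ` is not a root, `⁅β, ⁅γ, δ⁆⁆ = 0`, whereas `⁅γ, ⁅β, δ⁆⁆` is a nonzero multiple of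
  -- `⁅γ, ζ⁆`; hence `⁅⁅β, γ⁆, δ⁆ ≠ 0`
  have hjac := leibniz_lie (rootVector β) (rootVector γ) (rootVector δ)
  rw [lie_rootVector_eq_zero (hno γ δ hγ hδ hγζ hne)
    (root_add_ne_zero_of_heightRel b S (by omega)), lie_zero] at hjac
  obtain ⟨c, hc0, hc⟩ := exists_lie_rootVector_eq hβδ
  obtain ⟨σ, hσ⟩ := hall γ hγ hγζ
  rw [add_comm] at hσ
  rw [hc, lie_smul] at hjac
  by_cases hβγ : (rootSystem H).root β + (rootSystem H).root γ ∈ Set.range (rootSystem H).root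
  · obtain ⟨τ, hτ⟩ := hβγ
    have hτ1 : heightRel b S τ = 1 := by rw [heightRel_add b S hτ]; omega
    refine hno τ δ hτ1 hδ ?_ hne ⟨σ, by rw [hσ, hτ, hβδ]; abel⟩
    rintro rfl
    exact hγδ ((rootSystem H).root.injective (add_left_cancel (hτ.symm.trans hβδ)))
  · rw [lie_rootVector_eq_zero hβγ (root_add_ne_zero_of_heightRel b S (by omega)), zero_lie,
      zero_add, eq_comm, smul_eq_zero] at hjac
    exact lie_rootVector_ne_zero hσ (hjac.resolve_left hc0)

/-- A Monge root `ζ` is a simple root: some simple root `j` makes an acute angle with `ζ`, and if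
`j ≠ ζ`, then one of `j`, `ζ - j` is a root of height one that differs from `ζ` by a root. -/
lemma IsMongeRoot.exists_simple (hζ : IsMongeRoot b S ζ)
    (hcard : 2 < {γ : H.root | heightRel b S γ = 1}.ncard) :
    ∃ α ∈ S, (α : H.root) = ζ := by
  have hpos : b.IsPos ζ := (isPos_iff_coeff_nonneg b ζ).mpr
    (coeff_nonneg_of_heightRel_pos (b := b) (S := S) (by rw [hζ.1]; norm_num))
  obtain ⟨j, hj, hjζ⟩ := hpos.exists_mem_support_pos_pairingIn
  lift j to b.support using hj
  rw [(rootSystem H).zero_lt_pairingIn_iff'] at hjζ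
  by_cases hjS : j ∈ S
  · refine ⟨j, hjS, ?_⟩
    by_contra hne
    exact hζ.sub_notMem hcard (heightRel_simple_of_mem b hjS) hne
      ((rootSystem H).root_sub_root_mem_of_pairingIn_pos hjζ (Ne.symm hne))
  · exfalso
    have hj0 := heightRel_simple_of_notMem b hjS
    have hζ1 := hζ.1
    obtain ⟨δ, hδ⟩ := (rootSystem H).root_sub_root_mem_of_pairingIn_pos hjζ
      (by rintro rfl; omega)
    refine hζ.sub_notMem hcard (δ := δ) (by rw [heightRel_sub b S hδ]; omega) ?_ ⟨j, ?_⟩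
    · rintro rfl
      exact (rootSystem H).ne_zero j (sub_eq_self.mp hδ.symm)
    · rw [hδ]; abel

variable {ζ : b.support}

lemma IsMongeRoot.mem_iff_adj (hζ : IsMongeRoot b S ζ)
    (hcard : 2 < {γ : H.root | heightRel b S γ = 1}.ncard) {α : b.support} (hne : α ≠ ζ) :
    α ∈ S ↔ (dynkin b).Adj ζ α := by
  have hne' : (ζ : H.root) ≠ α := fun h ↦ hne (Subtype.ext h.symm)
  constructor
  · intro hα
    obtain ⟨σ, hσ⟩ := hζ.2.2 α (heightRel_simple_of_mem b hα) hne'.symm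
    exact dynkin_adj_iff.mpr ⟨hne.symm,
      (pairingIn_neg_of_add_mem hne' hσ (b.sub_notMem_range_root ζ.2 α.2)).ne⟩
  · intro hadj
    by_contra hα
    have hα0 := heightRel_simple_of_notMem b hα
    have hζ1 := hζ.1
    obtain ⟨δ, hδ⟩ := (rootSystem H).root_add_root_mem_of_pairingIn_neg
      (pairingIn_simple_neg_of_adj hadj) (b.root_ne_neg_of_ne ζ.2 α.2 hne')
    refine hζ.sub_notMem hcard (δ := δ) (by rw [heightRel_add b S hδ]; omega) ?_
      ⟨negRoot α, ?_⟩
    · rintro rfl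
      exact (rootSystem H).ne_zero α (by simpa [-rootSystem_root_apply] using hδ)
    · rw [hδ, root_negRoot]; abel

/-- A simple Monge root occurs in all roots of height at least two, since it occurs in those of
height two and every root of larger height is the sum of one of smaller height and a positive
root. -/
lemma IsMongeRoot.coeff_pos (hζ : IsMongeRoot b S ζ) {ρ : H.root}
    (hρ : 2 ≤ heightRel b S ρ) : 0 < coeff b ρ ζ := by
  obtain ⟨n, hn⟩ : ∃ n : ℕ, heightRel b S ρ = n + 2 := ⟨(heightRel b S ρ - 2).toNat, by omega⟩
  clear hρ
  induction n generalizing ρ with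
  | zero =>
    obtain ⟨γ, δ, hγ, hδ, h⟩ := exists_add_of_two_le_heightRel b S (ρ := ρ) (by omega)
    have hγnn := coeff_nonneg_of_heightRel_pos (b := b) (S := S) (γ := γ) (by omega) ζ
    have hδnn := coeff_nonneg_of_heightRel_pos (b := b) (S := S) (γ := δ) (by omega) ζ
    rw [coeff_add b h]
    by_cases hγζ : γ = ζ
    · rw [hγζ, coeff_simple_self]; omega
    · by_cases hδζ : δ = ζ
      · rw [hδζ, coeff_simple_self]; omega
      · exact absurd ⟨ρ, h⟩ (hζ.2.1 γ δ hγ (by omega) hγζ hδζ)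
  | succ n ih =>
    obtain ⟨γ, δ, hγ, hδ, h⟩ := exists_add_of_two_le_heightRel b S (ρ := ρ) (by omega)
    have hγnn := coeff_nonneg_of_heightRel_pos (b := b) (S := S) (γ := γ) (by omega) ζ
    have := ih (ρ := δ) (by omega)
    rw [coeff_add b h]
    omega

lemma IsMongeRoot.coeff_le_one (hζ : IsMongeRoot b S ζ) {α : b.support} (hα : α ∈ S)
    {γ : H.root} (hγ : coeff b γ ζ = 0) : coeff b γ α ≤ 1 := by
  by_contra! h
  have hnn := coeff_nonneg_of_pos b (i := γ) (α := α) (by omega)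
  have : coeff b γ α ≤ heightRel b S γ :=
    Finset.single_le_sum (f := coeff b γ) (fun β _ ↦ hnn β) hα
  have := hζ.coeff_pos (ρ := γ) (by omega)
  omega

end RootsToDiagram

/-! ### Subalgebras defined by subdiagrams -/

section Subdiagram

variable {b : (rootSystem H).Base} {Υ : Set b.support}

lemma simple_mem_subdiagramRoots {β : b.support} (hβ : β ∈ Υ) :
    (β : H.root) ∈ subdiagramRoots b Υ :=
  fun _ hα ↦ coeff_simple_of_ne b (by rintro rfl; exact hα hβ)

lemma negRoot_mem_subdiagramRoots {γ : H.root} (hγ : γ ∈ subdiagramRoots b Υ) :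
    negRoot γ ∈ subdiagramRoots b Υ :=
  fun α hα ↦ by rw [coeff_negRoot, hγ α hα, neg_zero]

lemma subdiagramCartan_le (b : (rootSystem H).Base) (Υ : Set b.support) :
    subdiagramCartan b Υ ≤ H.toSubmodule := by
  refine Submodule.span_le.mpr ?_
  rintro _ ⟨β, -, rfl⟩
  exact ((rootSystem H).coroot β : H).2

lemma coe_negRoot (γ : H.root) : (((negRoot γ).1 : Weight ℂ H 𝔤) : H → ℂ) = -γ.1 := by
  funext x
  exact LinearMap.congr_fun (root_negRoot γ) x

lemma rootVector_negRoot_mem (γ : H.root) :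
    rootVector (negRoot γ) ∈ rootSpace H (-(γ.1 : Weight ℂ H 𝔤)) := by
  rw [← coe_negRoot]
  exact rootVector_mem _

lemma rootVector_simple_mem_subdiagramAlgebra {β : b.support} (hβ : β ∈ Υ) :
    rootVector β.1 ∈ subdiagramAlgebra b Υ ∧
      rootVector (negRoot β.1) ∈ subdiagramAlgebra b Υ :=
  ⟨LieSubalgebra.subset_lieSpan (Set.mem_biUnion hβ (Or.inl (rootVector_mem β.1))),
    LieSubalgebra.subset_lieSpan (Set.mem_biUnion hβ (Or.inr (rootVector_negRoot_mem β.1)))⟩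

lemma coroot_mem_subdiagramAlgebra {β : b.support} (hβ : β ∈ Υ) :
    (((rootSystem H).coroot β : H) : 𝔤) ∈ subdiagramAlgebra b Υ := by
  have hα : β.1.1.IsNonZero := LieSubalgebra.isNonZero_coe_root β.1
  obtain ⟨t, e, f, isSl2, he, hf⟩ := exists_isSl2Triple_of_weight_isNonZero hα
  obtain rfl := isSl2.h_eq_coroot hα he hf
  rw [rootSystem_coroot_apply, ← isSl2.lie_e_f]
  exact LieSubalgebra.lie_mem _
    (LieSubalgebra.subset_lieSpan (Set.mem_biUnion hβ (Or.inl he)))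
    (LieSubalgebra.subset_lieSpan (Set.mem_biUnion hβ (Or.inr hf)))

lemma rootVector_mem_subdiagramAlgebra_of_isPos {γ : H.root} (hγ : b.IsPos γ)
    (hmem : γ ∈ subdiagramRoots b Υ) :
    rootVector γ ∈ subdiagramAlgebra b Υ ∧ rootVector (negRoot γ) ∈ subdiagramAlgebra b Υ := by
  suffices (∀ α, 0 ≤ coeff b γ α) ∧ (γ ∈ subdiagramRoots b Υ →
      rootVector γ ∈ subdiagramAlgebra b Υ ∧ rootVector (negRoot γ) ∈ subdiagramAlgebra b Υ) from
    this.2 hmem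
  clear hmem
  refine hγ.induction_on_add (p := fun γ ↦ (∀ α, 0 ≤ coeff b γ α) ∧ (γ ∈ subdiagramRoots b Υ →
      rootVector γ ∈ subdiagramAlgebra b Υ ∧ rootVector (negRoot γ) ∈ subdiagramAlgebra b Υ))
      ?_ ?_
  · intro i hi
    lift i to b.support using hi
    refine ⟨(isPos_iff_coeff_nonneg b i).mp (b.isPos_of_mem_support i.2), fun hmem ↦ ?_⟩
    refine rootVector_simple_mem_subdiagramAlgebra ?_
    by_contra hi
    have := hmem i hi
    simp at this
  · intro i j k hk ⟨hi, ih⟩ hj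
    lift j to b.support using hj
    have hkc := coeff_add b hk
    have hjnn := (isPos_iff_coeff_nonneg b j).mp (b.isPos_of_mem_support j.2)
    refine ⟨fun α ↦ by rw [hkc]; exact add_nonneg (hi α) (hjnn α), fun hmem ↦ ?_⟩
    have hiΥ : i ∈ subdiagramRoots b Υ := fun α hα ↦ by
      have := hmem α hα
      have := hkc α
      have := hi α
      have := hjnn α
      omega
    have hjΥ : j ∈ Υ := by
      by_contra hjΥ
      have h1 := hmem j hjΥ
      rw [hkc, coeff_simple_self] at h1
      have := hi j
      omega
    obtain ⟨hi1, hi2⟩ := ih hiΥ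
    obtain ⟨hj1, hj2⟩ := rootVector_simple_mem_subdiagramAlgebra hjΥ
    have hk' : (rootSystem H).root (negRoot k) =
        (rootSystem H).root (negRoot i) + (rootSystem H).root (negRoot j) := by
      rw [root_negRoot, hk, root_negRoot, root_negRoot]
      abel
    obtain ⟨c, hc0, hc⟩ := exists_lie_rootVector_eq hk
    obtain ⟨d, hd0, hd⟩ := exists_lie_rootVector_eq hk'
    have h1 := (subdiagramAlgebra b Υ).lie_mem hi1 hj1
    have h2 := (subdiagramAlgebra b Υ).lie_mem hi2 hj2
    rw [hc] at h1
    rw [hd] at h2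
    exact ⟨((subdiagramAlgebra b Υ).toSubmodule.smul_mem_iff hc0).mp h1,
      ((subdiagramAlgebra b Υ).toSubmodule.smul_mem_iff hd0).mp h2⟩

lemma rootVector_mem_subdiagramAlgebra {γ : H.root} (hmem : γ ∈ subdiagramRoots b Υ) :
    rootVector γ ∈ subdiagramAlgebra b Υ := by
  rcases coeff_nonneg_or_nonpos b γ with h | h
  · exact (rootVector_mem_subdiagramAlgebra_of_isPos
      ((isPos_iff_coeff_nonneg b γ).mpr h) hmem).1
  · have := (rootVector_mem_subdiagramAlgebra_of_isPos ((isPos_iff_coeff_nonneg b (negRoot γ)).mpr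
      (by simpa using h)) (negRoot_mem_subdiagramRoots hmem)).2
    rwa [negRoot_negRoot] at this

lemma exists_lie_rootVector_negRoot_eq (γ : H.root) :
    ∃ c : ℂ, ⁅rootVector γ, rootVector (negRoot γ)⁆ =
      c • (((rootSystem H).coroot γ : H) : 𝔤) := by
  have hmem : killingForm ℂ 𝔤 (rootVector γ) (rootVector (negRoot γ)) •
      (cartanEquivDual H).symm γ.1.toLinear ∈ (corootSpace γ.1).toSubmodule :=
    Submodule.smul_mem _ _ (cartanEquivDual_symm_apply_mem_corootSpace γ.1)
  rw [coe_corootSpace_eq_span_singleton] at hmem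
  obtain ⟨c, hc⟩ := Submodule.mem_span_singleton.mp hmem
  refine ⟨c, ?_⟩
  rw [lie_eq_killingForm_smul_of_mem_rootSpace_of_mem_rootSpace_neg (rootVector_mem γ)
    (rootVector_negRoot_mem γ)]
  exact (congrArg Subtype.val hc).symm

/-- The sum of the Cartan subalgebra and the root spaces of a subdiagram is stable under the
generators of the subalgebra. -/
lemma lie_rootVector_mem_sup {γ : H.root} {β : b.support} (hβ : β ∈ Υ)
    (hγ : γ = β ∨ γ = negRoot β) {v : 𝔤}
    (hv : v ∈ subdiagramCartan b Υ ⊔ Submodule.span ℂ (rootVector '' subdiagramRoots b Υ)) :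
    ⁅rootVector γ, v⁆ ∈
      subdiagramCartan b Υ ⊔ Submodule.span ℂ (rootVector '' subdiagramRoots b Υ) := by
  have hγR : γ ∈ subdiagramRoots b Υ := by
    rcases hγ with rfl | rfl
    · exact simple_mem_subdiagramRoots hβ
    · exact negRoot_mem_subdiagramRoots (simple_mem_subdiagramRoots hβ)
  have hcoroot : (((rootSystem H).coroot β : H) : 𝔤) ∈ subdiagramCartan b Υ :=
    Submodule.subset_span ⟨β, hβ, rfl⟩
  obtain ⟨t, ht, w, hw, rfl⟩ := Submodule.mem_sup.mp hv
  clear hv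
  rw [lie_add]
  refine Submodule.add_mem _ (Submodule.mem_sup_right ?_) ?_
  · have h1 : ⁅t, rootVector γ⁆ = (γ.1 : Weight ℂ H 𝔤) ⟨t, subdiagramCartan_le b Υ ht⟩ •
        rootVector γ :=
      lie_eq_smul_of_mem_rootSpace (rootVector_mem γ) ⟨t, subdiagramCartan_le b Υ ht⟩
    rw [← lie_skew, h1]
    exact Submodule.neg_mem _ (Submodule.smul_mem _ _ (Submodule.subset_span ⟨γ, hγR, rfl⟩))
  · induction hw using Submodule.span_induction with
    | mem w hw =>
      obtain ⟨δ, hδ, rfl⟩ := hw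
      by_cases h0 : (rootSystem H).root γ + (rootSystem H).root δ = 0
      · refine Submodule.mem_sup_left ?_
        have hδγ : δ = negRoot γ := by
          apply (rootSystem H).root.injective
          rw [root_negRoot]
          exact eq_neg_of_add_eq_zero_right h0
        obtain ⟨c, hc⟩ := exists_lie_rootVector_negRoot_eq β.1
        rcases hγ with rfl | rfl
        · rw [hδγ, hc]
          exact Submodule.smul_mem _ _ hcoroot
        · rw [hδγ, negRoot_negRoot, ← lie_skew, hc]
          exact Submodule.neg_mem _ (Submodule.smul_mem _ _ hcoroot)
      · refine Submodule.mem_sup_right (lie_rootVector_mem_span h0 fun ρ hρ α hα ↦ ?_)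
        rw [coeff_add b hρ, hγR α hα, hδ α hα, add_zero]
    | zero => simp
    | add u v _ _ hu hv =>
      rw [lie_add]
      exact Submodule.add_mem _ hu hv
    | smul c u _ hu =>
      rw [lie_smul]
      exact Submodule.smul_mem _ c hu

/-- The subalgebra of a subdiagram is the sum of its Cartan subalgebra and its root spaces. To see
that this sum `V` contains all brackets of the generators, it is enough to know that the generators
lie in `V` and that their adjoint actions preserve `V`: both properties pass to brackets. -/
lemma toSubmodule_subdiagramAlgebra (b : (rootSystem H).Base) (Υ : Set b.support) :
    (subdiagramAlgebra b Υ).toSubmodule =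
      subdiagramCartan b Υ ⊔ Submodule.span ℂ (rootVector '' subdiagramRoots b Υ) := by
  set V := subdiagramCartan b Υ ⊔ Submodule.span ℂ (rootVector '' subdiagramRoots b Υ) with hV
  apply le_antisymm
  · intro x hx
    suffices x ∈ V ∧ ∀ v ∈ V, ⁅x, v⁆ ∈ V from this.1
    have hgen : ∀ (β : b.support) (γ : H.root) (y : 𝔤), β ∈ Υ → (γ = β ∨ γ = negRoot β) →
        y ∈ rootSpace H γ.1 → y ∈ V ∧ ∀ v ∈ V, ⁅y, v⁆ ∈ V := by
      intro β γ y hβ hγ hy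
      obtain ⟨c, rfl⟩ := exists_smul_rootVector hy
      refine ⟨Submodule.smul_mem _ _ (Submodule.mem_sup_right (Submodule.subset_span
        ⟨γ, ?_, rfl⟩)), fun v hv ↦ ?_⟩
      · rcases hγ with rfl | rfl
        · exact simple_mem_subdiagramRoots hβ
        · exact negRoot_mem_subdiagramRoots (simple_mem_subdiagramRoots hβ)
      · rw [smul_lie]
        exact Submodule.smul_mem _ _ (lie_rootVector_mem_sup hβ hγ hv)
    refine LieSubalgebra.lieSpan_induction (R := ℂ)
      (p := fun x _ ↦ x ∈ V ∧ ∀ v ∈ V, ⁅x, v⁆ ∈ V) ?_ ?_ ?_ ?_ ?_ hx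
    · intro y hy
      obtain ⟨β, hβ, hy | hy⟩ := Set.mem_iUnion₂.mp hy
      · exact hgen β β y hβ (Or.inl rfl) hy
      · refine hgen β (negRoot β) y hβ (Or.inr rfl) ?_
        rw [coe_negRoot]
        exact hy
    · exact ⟨V.zero_mem, fun v _ ↦ by simp⟩
    · intro y z _ _ hy hz
      exact ⟨V.add_mem hy.1 hz.1, fun v hv ↦ by
        rw [add_lie]; exact V.add_mem (hy.2 v hv) (hz.2 v hv)⟩
    · intro c y _ hy
      exact ⟨V.smul_mem c hy.1, fun v hv ↦ by rw [smul_lie]; exact V.smul_mem c (hy.2 v hv)⟩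
    · intro y z _ _ hy hz
      refine ⟨hy.2 z hz.1, fun v hv ↦ ?_⟩
      rw [lie_lie]
      exact V.sub_mem (hy.2 _ (hz.2 v hv)) (hz.2 _ (hy.2 v hv))
  · refine sup_le (Submodule.span_le.mpr ?_) (Submodule.span_le.mpr ?_)
    · rintro _ ⟨β, hβ, rfl⟩
      exact coroot_mem_subdiagramAlgebra hβ
    · rintro _ ⟨γ, hγ, rfl⟩
      exact rootVector_mem_subdiagramAlgebra hγ

lemma iSup_gradedPiece_subdiagram (b : (rootSystem H).Base) (Υ : Set b.support)
    (S : Finset b.support) :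
    ⨆ j, gradedPiece b (subdiagramCartan b Υ) (subdiagramRoots b Υ) S j =
      (subdiagramAlgebra b Υ).toSubmodule := by
  rw [iSup_gradedPiece, toSubmodule_subdiagramAlgebra]

lemma lie_mem_subdiagramGrading {S : Finset b.support} {i j : ℤ}
    {x y : subdiagramAlgebra b Υ} (hx : x ∈ subdiagramGrading b Υ S i)
    (hy : y ∈ subdiagramGrading b Υ S j) : ⁅x, y⁆ ∈ subdiagramGrading b Υ S (i + j) :=
  lie_mem_gradedPiece b S (subdiagramCartan_le b Υ) _ hx hy (by
    rw [iSup_gradedPiece_subdiagram]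
    exact ⁅x, y⁆.2)

lemma isInternal_subdiagramGrading (b : (rootSystem H).Base) (Υ : Set b.support)
    (S : Finset b.support) : DirectSum.IsInternal (subdiagramGrading b Υ S) := by
  apply DirectSum.isInternal_submodule_of_iSupIndep_of_iSup_eq_top
  · intro j
    rw [Submodule.disjoint_def]
    intro x hx hx'
    apply Subtype.ext
    refine (Submodule.disjoint_def.mp
      (iSupIndep_gradedPiece b S (subdiagramCartan_le b Υ) (subdiagramRoots b Υ) j)) x.1 hx ?_
    have hle : ⨆ (i : ℤ) (_ : i ≠ j), subdiagramGrading b Υ S i ≤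
        (⨆ (i : ℤ) (_ : i ≠ j),
          gradedPiece b (subdiagramCartan b Υ) (subdiagramRoots b Υ) S i).comap
            (subdiagramAlgebra b Υ).toSubmodule.subtype :=
      iSup₂_le fun i hi ↦ Submodule.comap_mono (le_iSup₂_of_le i hi le_rfl)
    exact hle hx'
  · apply Submodule.map_injective_of_injective
      (subdiagramAlgebra b Υ).toSubmodule.injective_subtype
    rw [Submodule.map_iSup, Submodule.map_top, Submodule.range_subtype]
    refine Eq.trans (iSup_congr fun j ↦ ?_) (iSup_gradedPiece_subdiagram b Υ S)
    rw [subdiagramGrading, Submodule.map_comap_subtype, inf_eq_right,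
      ← iSup_gradedPiece_subdiagram b Υ S]
    exact le_iSup _ j

lemma subdiagramGrading_ne_bot {S : Finset b.support} {γ : H.root}
    (hγ : γ ∈ subdiagramRoots b Υ) : subdiagramGrading b Υ S (heightRel b S γ) ≠ ⊥ := by
  intro hbot
  have hmem : (⟨rootVector γ, rootVector_mem_subdiagramAlgebra hγ⟩ : subdiagramAlgebra b Υ) ∈
      subdiagramGrading b Υ S (heightRel b S γ) :=
    rootVector_mem_gradedPiece b (subdiagramCartan b Υ) hγ rfl
  rw [hbot, Submodule.mem_bot] at hmem
  exact rootVector_ne_zero γ (congrArg Subtype.val hmem)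

/-- The grading of `𝔤(Υ)` defined by `α` has depth one if and only if `α` has coefficient at most
one in all roots of `𝔤(Υ)`. -/
theorem isDepthGrading_one_subdiagramGrading_iff {α : b.support} (hα : α ∈ Υ) :
    IsDepthGrading 1 (subdiagramGrading b Υ {α}) ↔
      ∀ γ ∈ subdiagramRoots b Υ, coeff b γ α ≤ 1 := by
  constructor
  · intro h γ hγ
    by_contra! hcon
    refine subdiagramGrading_ne_bot (S := {α}) hγ (h.eq_bot_of_lt _ ?_)
    rw [heightRel_singleton, Int.abs_eq_natAbs]
    omega
  · intro h
    have hbot : ∀ j : ℤ, ((1 : ℕ) : ℤ) < |j| → subdiagramGrading b Υ {α} j = ⊥ := by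
      intro j hj
      rw [Int.abs_eq_natAbs] at hj
      have hempty : {γ : H.root | γ ∈ subdiagramRoots b Υ ∧ heightRel b {α} γ = j} = ∅ := by
        ext γ
        simp only [Set.mem_ofPred_eq, heightRel_singleton, Set.mem_empty_iff_false, iff_false,
          not_and]
        intro hγ hγj
        have h1 := h γ hγ
        have h2 := h _ (negRoot_mem_subdiagramRoots hγ)
        rw [coeff_negRoot] at h2
        omega
      rw [subdiagramGrading, gradedPiece_of_ne_zero _ _ _ _ (by omega), hempty,
        Set.image_empty, Submodule.span_empty, Submodule.comap_bot]
      exact Submodule.ker_subtype _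
    have hαR := simple_mem_subdiagramRoots hα
    refine ⟨isInternal_subdiagramGrading b Υ {α}, hbot,
      fun i j x y hx hy ↦ lie_mem_subdiagramGrading hx hy, fun j hj ↦ ?_, ?_, ?_⟩
    · rw [hbot (j - 1) (by rw [Int.abs_eq_natAbs]; omega), eq_bot_iff, Submodule.span_le]
      rintro _ ⟨x, hx, y, hy, rfl⟩
      rw [← hbot (j - 1) (by rw [Int.abs_eq_natAbs]; omega), sub_eq_neg_add]
      exact lie_mem_subdiagramGrading hx hy
    · simpa using subdiagramGrading_ne_bot (S := {α}) hαR
    · simpa using subdiagramGrading_ne_bot (S := {α}) (negRoot_mem_subdiagramRoots hαR)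

end Subdiagram

end Monge

end

theorem mainTheorem3 {𝔤 : Type*} [LieRing 𝔤] [LieAlgebra ℂ 𝔤] [FiniteDimensional ℂ 𝔤]
    [LieAlgebra.IsSimple ℂ 𝔤] (H : LieSubalgebra ℂ 𝔤) [H.IsCartanSubalgebra]
    (b : (rootSystem H).Base) (S : Finset b.support)
    (hdim : 2 < Module.finrank ℂ (Monge.grading b S (-1))) :
    Monge.IsMongeType (Monge.grading b S) ↔
      ∃ ζ ∈ S,
        (∀ α : b.support, α ≠ ζ → (α ∈ S ↔ (Monge.dynkin b).Adj ζ α)) ∧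
        (∀ α ∈ S, α ≠ ζ →
          Monge.IsDepthGrading 1 (Monge.subdiagramGrading b (Monge.component b ζ α) {α})) := by
  have hcard := hdim
  rw [Monge.finrank_grading_neg b S one_pos] at hcard
  constructor
  · intro h
    obtain ⟨_, hζ⟩ := Monge.exists_isMongeRoot_of_isMongeType h
    obtain ⟨ζ, hζS, rfl⟩ := hζ.exists_simple hcard
    refine ⟨ζ, hζS, fun α hα ↦ hζ.mem_iff_adj hcard hα, fun α hαS hα ↦ ?_⟩
    rw [Monge.isDepthGrading_one_subdiagramGrading_iff (Monge.self_mem_component hα)]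
    exact fun γ hγ ↦ hζ.coeff_le_one hαS (hγ ζ (Monge.notMem_component_self ζ α))
  · rintro ⟨ζ, hζS, hadj, hcomp⟩
    refine Monge.isMongeType_of_isMongeRoot (Monge.isMongeRoot_of_dynkin hζS hadj
      fun α hαS hα ↦ ?_) (by omega)
    rw [← Monge.isDepthGrading_one_subdiagramGrading_iff (Monge.self_mem_component hα)]
    exact hcomp α hαS hα
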